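/- **Setting.** Let $q(\vec x) \,{:\!-}\, g_1,\dots,g_m$ ($m\ge 1$) be a conjunctive query without self-joins: each $g_i$ is a relational atom over variables and constants, different atoms refer to different relations, and every head variable occurs in some atom. Let $\mathrm{Var}(g_i)$ be the set of variables of $g_i$, $\mathrm{Var}(q)=\bigcup_i \mathrm{Var}(g_i)$, $\mathrm{HVar}(q)=\vec x$ the head variables, and $\mathrm{EVar}(q)=\mathrm{Var}(q)\setminus\mathrm{HVar}(q)$ the existential variables. *Databases.* A probabilistic database $D$ is a finite set of tuples over a finite vocabulary, each tuple present independently with a given probability in $[0,1]$; $A$ is its active domain (the set of constants occurring in $D$). For an assignment $a$ of constants to the head variables, the reliability $r(q)(a)$ is the probability that $a$ is an answer of $q$ in a random world (for Boolean $q$: that $q$ is true). *Dissociations.* A dissociation of $q$ is a family $\Delta=(\vec y_1,\dots,\vec y_m)$ with $\vec y_i\subseteq \mathrm{EVar}(q)\setminus\mathrm{Var}(g_i)$. The dissociated query $q^\Delta$ has the same head variables and the atoms $R_i^{\vec y_i}(\vec x_i,\vec y_i)$, where $g_i=R_i(\vec x_i)$. It is evaluated on the dissociated database $D^\Delta$,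 in which the table of $R_i^{\vec y_i}$ is $R_i\times A^{\vec y_i}$, each copy of a tuple being an independent tuple with the probability of the original. $\Delta$ is safe if $q^\Delta$ is hierarchical: for any two existential variables $x,y$ the sets $sg(x),sg(y)$ of atoms containing them are disjoint or one contains the other. *Plans.* Plans are given by $P ::= g_i \mid \pi_{-\vec y}P \mid\ \bowtie[P_1,\dots,P_k]$ ($k\ge2$), up to the order of the operands of joins, with $\mathrm{HVar}(g_i)=\mathrm{Var}(g_i)$, $\mathrm{HVar}(\pi_{-\vec y}P)=\mathrm{HVar}(P)\setminus\vec y$, $\mathrm{HVar}(\bowtie[P_1,\dots,P_k])=\bigcup_j\mathrm{HVar}(P_j)$. It is required that joins and projections alternate (no join is an operand of a join, no projection an operand of a projection) and that $\emptyset\ne\vec y\subseteq\mathrm{HVar}(P)$ in every $\pi_{-\vec y}P$. A plan for $q$ uses each atom of $q$ exactly once, projects each variable away at most once, projects away no head variable of $q$, and satisfies $\mathrm{HVar}(P)=\mathrm{HVar}(q)$. It is safe if, for every join, all operands have the same head variables apart from those in $\mathrm{HVar}(q)$. The extensional score $\mathrm{score}_D(P)(a)$ is the probability computed for the tuple $a$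 (0 if the tuple is not returned) when $P$ is evaluated on $D$ with joins multiplying the probabilities of the joined tuples and projections combining the probabilities $p_i$ of the tuples that agree on the remaining variables to $1-\prod_i(1-p_i)$. **Theorem (Safe dissociation).** There is a bijection, not depending on any database, between the query plans $P$ for $q$ and the safe dissociations $\Delta$ of $q$, with the following properties for every plan $P$ for $q$ and the corresponding $\Delta$. 1. $\Delta$ is obtained from $P$ by adding, for each join $\bowtie[P_1,\dots,P_k]$ in $P$ with $\mathrm{JVar}=\bigcup_j \mathrm{HVar}(P_j)$ and each $j$, the missing existential variables $(\mathrm{JVar}\setminus\mathrm{HVar}(P_j))\cap\mathrm{EVar}(q)$ to $\vec y_i$ for every atom $g_i$ occurring in $P_j$. 2. The dissociated query $q^\Delta$ has exactly one safe plan $P^\Delta$, and dropping the variables $\vec y_i$ from the atoms of $P^\Delta$ (and keeping the sets of variables that are projected away) yields $P$. 3. For every probabilistic database $D$ and every assignment $a$ of constants to the head variables, the reliability of the dissociated query on $D^\Delta$ equals the score of the plan on $D$: $$r(q^\Delta)(a)=\mathrm{score}_{D}(P)(a)=\mathrm{score}_{D^\Delta}(P^\Delta)(a).$$ -/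

import Mathlib

namespace SafeDissociation

noncomputable section

open scoped Classical

universe u v w z

/-- A finite relational vocabulary. `Attr r` is the (finite) set of attributes (argument positions)
of the relation symbol `r`. -/
structure Vocab where
  Rel : Type u
  Attr : Rel → Type v
  [fintypeRel : Fintype Rel]
  [fintypeAttr : ∀ r, Fintype (Attr r)]

attribute [instance] Vocab.fintypeRel Vocab.fintypeAttr

/-- A term is a variable or a constant. -/
inductive Term (V : Type w) (C : Type z) where
  | var (x : V) : Term V C
  | const (c : C) : Term V C

variable {σ : Vocab.{u, v}} {V : Type w} {C : Type z} {m : ℕ}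

/-- The variables of a term. -/
def Term.vars : Term V C → Finset V
  | .var x => {x}
  | .const _ => ∅

/-- The value of a term under a valuation of the variables. -/
def Term.eval (ν : V → C) : Term V C → C
  | .var x => ν x
  | .const c => c

/-- A relational atom: a relation symbol applied to variables and constants. -/
structure Atom (σ : Vocab.{u, v}) (V : Type w) (C : Type z) where
  rel : σ.Rel
  args : σ.Attr rel → Term V C

/-- A fact: a relation symbol together with a tuple of constants. -/
abbrev Fact (σ : Vocab.{u, v}) (C : Type z) : Type (max u v z) :=
  Σ r : σ.Rel, σ.Attr r → C

/-- `Var(g)`, the set of variables of an atom. -/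
def Atom.vars (g : Atom σ V C) : Finset V :=
  Finset.univ.biUnion fun k => (g.args k).vars

/-- The fact obtained by replacing each variable of an atom by its value. -/
def Atom.ground (g : Atom σ V C) (ν : V → C) : Fact σ C :=
  ⟨g.rel, fun k => (g.args k).eval ν⟩

/-! ### Conjunctive queries -/

/-- A conjunctive query with subgoals `g₁, …, g_m` and a set of head variables, each of which
occurs in some subgoal. -/
structure CQ (σ : Vocab.{u, v}) (V : Type w) (C : Type z) (m : ℕ) where
  atom : Fin m → Atom σ V C
  head : Finset V
  head_subset : head ⊆ Finset.univ.biUnion fun i => (atom i).vars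

namespace CQ

/-- Different subgoals refer to different relations. -/
def SelfJoinFree (q : CQ σ V C m) : Prop :=
  Function.Injective fun i => (q.atom i).rel

/-- `Var(q)`. -/
def vars (q : CQ σ V C m) : Finset V :=
  Finset.univ.biUnion fun i => (q.atom i).vars

/-- `EVar(q)`, the existential (non-head) variables. -/
def evars (q : CQ σ V C m) : Finset V :=
  q.vars \ q.head

/-- `sg(x)`, the set of subgoals that contain `x`. -/
def sg (q : CQ σ V C m) (x : V) : Finset (Fin m) :=
  Finset.univ.filter fun i => x ∈ (q.atom i).vars

/-- Hierarchical queries; a self-join-free conjunctive query is called safe iff it is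
hierarchical. -/
def Hierarchical (q : CQ σ V C m) : Prop :=
  ∀ x ∈ q.evars, ∀ y ∈ q.evars,
    q.sg x ⊆ q.sg y ∨ Disjoint (q.sg x) (q.sg y) ∨ q.sg y ⊆ q.sg x

/-- The query `q` holds in the set of facts `W` for the answer tuple `(a x)` indexed by the head
variables `x`. Only the values of `a` on the head variables matter. -/
def Holds (q : CQ σ V C m) (W : Finset (Fact σ C)) (a : V → C) : Prop :=
  ∃ ν : V → C, (∀ x ∈ q.head, ν x = a x) ∧ ∀ i, (q.atom i).ground ν ∈ W

end CQ

/-! ### Tuple-independent probabilistic databases -/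

/-- A tuple-independent probabilistic database: a finite table for each relation symbol, each tuple
carrying a probability. -/
structure PDB (σ : Vocab.{u, v}) (C : Type z) where
  tuples : ∀ r : σ.Rel, Finset (σ.Attr r → C)
  prob : ∀ r : σ.Rel, (σ.Attr r → C) → ℝ
  prob_nonneg : ∀ r, ∀ t ∈ tuples r, 0 ≤ prob r t
  prob_le_one : ∀ r, ∀ t ∈ tuples r, prob r t ≤ 1

namespace PDB

/-- All tuples of the database. -/
def facts (D : PDB σ C) : Finset (Fact σ C) :=
  Finset.univ.sigma D.tuples

/-- The active domain: all constants that occur in the database. -/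
def adom (D : PDB σ C) : Finset C :=
  Finset.univ.biUnion fun r => (D.tuples r).biUnion fun t => Finset.univ.image t

/-- The probability of the possible world `W ⊆ D.facts`: every tuple is included independently
with its own probability. -/
def worldProb (D : PDB σ C) (W : Finset (Fact σ C)) : ℝ :=
  (∏ t ∈ W, D.prob t.1 t.2) * ∏ t ∈ D.facts \ W, (1 - D.prob t.1 t.2)

end PDB

/-- The query reliability `r(q)`: the probability that the answer tuple `a` is returned by `q`
(for a Boolean query: that `q` is true) in a random possible world of `D`. -/
def CQ.reliability (q : CQ σ V C m) (D : PDB σ C) (a : V → C) : ℝ :=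
  ∑ W ∈ D.facts.powerset, if q.Holds W a then D.worldProb W else 0

/-! ### Dissociations -/

namespace CQ

/-- A dissociation of `q`: the `i`-th subgoal is extended by a set `Δ i` of existential variables of
`q` that do not occur in it. -/
def IsDissociation (q : CQ σ V C m) (Δ : Fin m → Finset V) : Prop :=
  ∀ i, Δ i ⊆ q.evars \ (q.atom i).vars

/-- The vocabulary of the dissociated query: one relation symbol for each subgoal, with one new
attribute for each added variable. -/
def dissVocab (q : CQ σ V C m) (Δ : Fin m → Finset V) : Vocab.{0, max v w} where
  Rel := Fin m
  Attr := fun i => σ.Attr (q.atom i).rel ⊕ {y : V // y ∈ Δ i}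
  fintypeRel := inferInstance
  fintypeAttr := fun _ => inferInstance

/-- The `i`-th subgoal of the dissociated query. -/
def dissAtom (q : CQ σ V C m) (Δ : Fin m → Finset V) (i : Fin m) : Atom (q.dissVocab Δ) V C where
  rel := i
  args := Sum.elim (q.atom i).args fun y => Term.var y.1

theorem vars_subset_dissAtom_vars (q : CQ σ V C m) (Δ : Fin m → Finset V) (i : Fin m) :
    (q.atom i).vars ⊆ (q.dissAtom Δ i).vars := by
  intro x hx
  simp only [Atom.vars, Finset.mem_biUnion, Finset.mem_univ, true_and] at hx ⊢
  obtain ⟨k, hk⟩ := hx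
  exact ⟨Sum.inl k, hk⟩

/-- The dissociated query `q^Δ`. -/
def dissociate (q : CQ σ V C m) (Δ : Fin m → Finset V) : CQ (q.dissVocab Δ) V C m where
  atom := q.dissAtom Δ
  head := q.head
  head_subset := by
    intro x hx
    obtain ⟨i, hi, hxi⟩ := Finset.mem_biUnion.1 (q.head_subset hx)
    exact Finset.mem_biUnion.2 ⟨i, hi, q.vars_subset_dissAtom_vars Δ i hxi⟩

/-- The dissociated database: the table of the `i`-th subgoal is the product of the original table
with one copy of the active domain for each variable of `Δ i`; each copy of a tuple carries the
probability of the original tuple. -/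
def dissociateDB (q : CQ σ V C m) (Δ : Fin m → Finset V) (D : PDB σ C) :
    PDB (q.dissVocab Δ) C where
  tuples := fun i =>
    ((D.tuples (q.atom i).rel) ×ˢ Fintype.piFinset fun _ : {y : V // y ∈ Δ i} => D.adom).image
      fun p => (Sum.elim p.1 p.2 : σ.Attr (q.atom i).rel ⊕ {y : V // y ∈ Δ i} → C)
  prob := fun i s => D.prob (q.atom i).rel fun k => s (Sum.inl k)
  prob_nonneg := by
    intro i t ht
    obtain ⟨p, hp, rfl⟩ := Finset.mem_image.1 ht
    exact D.prob_nonneg _ _ (Finset.mem_product.1 hp).1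
  prob_le_one := by
    intro i t ht
    obtain ⟨p, hp, rfl⟩ := Finset.mem_image.1 ht
    exact D.prob_le_one _ _ (Finset.mem_product.1 hp).1

/-- A dissociation is safe if the dissociated query is safe. -/
def IsSafeDissociation (q : CQ σ V C m) (Δ : Fin m → Finset V) : Prop :=
  q.IsDissociation Δ ∧ (q.dissociate Δ).Hierarchical

/-- The safe dissociations of `q`. -/
def SafeDiss (q : CQ σ V C m) : Type w :=
  {Δ : Fin m → Finset V // q.IsSafeDissociation Δ}

end CQ

/-! ### Query plans -/

/-- Plan expressions over the subgoals `g₁, …, g_m` of a query. The leaf `atom i` is the subgoal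
`gᵢ`, `proj y P` projects the variables `y` away (with duplicate elimination), and `join P` is the
`k`-ary natural join. The variables of a leaf are those of the `i`-th subgoal of the query over which
the plan is read, so reading a plan for `q^Δ` as a plan for `q` drops the dissociated variables. -/
inductive Plan (m : ℕ) (V : Type w) : Type w where
  | atom (i : Fin m) : Plan m V
  | proj (y : Finset V) (P : Plan m V) : Plan m V
  | join {k : ℕ} (P : Fin k → Plan m V) : Plan m V

namespace Plan

/-- Equality of plans up to the order of the operands of joins. -/
inductive Equiv : Plan m V → Plan m V → Prop where
  | atom (i : Fin m) : Equiv (.atom i) (.atom i)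
  | proj (y : Finset V) {P P' : Plan m V} (h : Equiv P P') : Equiv (.proj y P) (.proj y P')
  | join {k : ℕ} (P P' : Fin k → Plan m V) (π : Equiv.Perm (Fin k))
      (h : ∀ j, Equiv (P j) (P' (π j))) : Equiv (.join P) (.join P')

theorem Equiv.refl (P : Plan m V) : P.Equiv P := by
  induction P with
  | atom i => exact .atom i
  | proj y P ih => exact .proj y ih
  | join P ih => exact .join P P 1 ih

theorem Equiv.symm {P Q : Plan m V} (h : P.Equiv Q) : Q.Equiv P := by
  induction h with
  | atom i => exact .atom i
  | proj y _ ih => exact .proj y ih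
  | join P P' π _ ih =>
    refine .join P' P π⁻¹ fun j => ?_
    simpa using ih (π⁻¹ j)

theorem Equiv.trans {P Q R : Plan m V} (h : P.Equiv Q) (h' : Q.Equiv R) : P.Equiv R := by
  induction h generalizing R with
  | atom i => exact h'
  | proj y _ ih =>
    cases h' with
    | proj _ h' => exact .proj y (ih h')
  | join P P' π _ ih =>
    cases h' with
    | join _ P'' π' h' => exact .join P P'' (π' * π) fun j => ih j (h' (π j))

/-- The subgoals at the leaves, with multiplicity. -/
def leaves : Plan m V → Multiset (Fin m)
  | .atom i => {i}
  | .proj _ P => P.leaves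
  | .join P => ∑ j, (P j).leaves

/-- The variables that are projected away, once for every operator that does so. -/
def projected : Plan m V → Multiset V
  | .atom _ => 0
  | .proj y P => y.val + P.projected
  | .join P => ∑ j, (P j).projected

def IsProj : Plan m V → Prop
  | .proj _ _ => True
  | _ => False

def IsJoin : Plan m V → Prop
  | .join _ => True
  | _ => False

end Plan

namespace CQ

/-- `HVar(P)`, the head variables of a plan over the subgoals of `q`. -/
def headVars (q : CQ σ V C m) : Plan m V → Finset V
  | .atom i => (q.atom i).vars
  | .proj y P => q.headVars P \ y
  | .join P => Finset.univ.biUnion fun j => q.headVars (P j)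

/-- Joins have at least two operands, each projection projects away a nonempty set of head variables
of its operand, and joins and projections alternate. -/
def WellFormed (q : CQ σ V C m) : Plan m V → Prop
  | .atom _ => True
  | .proj y P => y.Nonempty ∧ y ⊆ q.headVars P ∧ ¬ P.IsProj ∧ q.WellFormed P
  | @Plan.join _ _ k P => 2 ≤ k ∧ ∀ j, ¬ (P j).IsJoin ∧ q.WellFormed (P j)

/-- `P` is a query plan for `q`: it is well formed, uses every subgoal of `q` exactly once,
projects every variable away at most once, never projects away a head variable of `q`, and returns
the head variables of `q`. -/
structure IsPlan (q : CQ σ V C m) (P : Plan m V) : Prop where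
  wellFormed : q.WellFormed P
  leaves_eq : P.leaves = (Finset.univ : Finset (Fin m)).val
  nodup_projected : P.projected.Nodup
  projected_notMem_head : ∀ y ∈ P.projected, y ∉ q.head
  headVars_eq : q.headVars P = q.head

/-- Query plans for `q` that are identified if they differ only in the order of the operands of
joins. -/
def planSetoid (q : CQ σ V C m) : Setoid {P : Plan m V // q.IsPlan P} where
  r := fun P P' => P.1.Equiv P'.1
  iseqv := ⟨fun P => .refl P.1, fun h => h.symm, fun h h' => h.trans h'⟩

/-- The query plans for `q`, up to the order of the operands of joins. -/
def QueryPlan (q : CQ σ V C m) : Type w :=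
  Quotient q.planSetoid

/-- The query plan represented by a plan expression. -/
def QueryPlan.mk {q : CQ σ V C m} (P : Plan m V) (hP : q.IsPlan P) : q.QueryPlan :=
  Quotient.mk q.planSetoid ⟨P, hP⟩

/-- A plan is safe if for any join all operands have the same head variables; the head variables of
the query are treated as constants here. -/
def SafePlan (q : CQ σ V C m) : Plan m V → Prop
  | .atom _ => True
  | .proj _ P => q.SafePlan P
  | .join P => (∀ i j, q.headVars (P i) \ q.head = q.headVars (P j) \ q.head) ∧
      ∀ j, q.SafePlan (P j)

/-- The dissociation of a plan: for each join with operands `P₁, …, P_k` and join variables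
`JVar = ⋃ⱼ HVar(Pⱼ)`, add the missing existential variables `JVar - HVar(Pⱼ)` to every subgoal that
occurs in `Pⱼ`. -/
def dissociationOf (q : CQ σ V C m) : Plan m V → Fin m → Finset V
  | .atom _, _ => ∅
  | .proj _ P, i => q.dissociationOf P i
  | .join P, i =>
      Finset.univ.biUnion fun j =>
        if i ∈ (P j).leaves then
          q.dissociationOf (P j) i ∪ ((q.headVars (.join P) \ q.headVars (P j)) \ q.head)
        else ∅

end CQ

/-- The valuation that agrees with `μ` on `y` and with `ν` elsewhere. -/
def override (ν : V → C) (y : Finset V) (μ : {x : V // x ∈ y} → C) : V → C :=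
  fun x => if h : x ∈ y then μ ⟨x, h⟩ else ν x

/-- The extensional score. `q.score D P ν` is the probability that the plan `P`, evaluated on `D`,
stores for the tuple `(ν x)` indexed by `x ∈ HVar(P)`, and `0` if that tuple is not returned. The
probabilistic join multiplies the probabilities of the joined tuples; the probabilistic projection
maps the probabilities `pᵢ` of the tuples that agree on the remaining variables to
`1 - ∏ᵢ (1 - pᵢ)`. All tuples returned by a plan have their values in the active domain, and a tuple
that is not returned contributes the factor `1 - 0`. -/
def CQ.score (q : CQ σ V C m) (D : PDB σ C) : Plan m V → (V → C) → ℝ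
  | .atom i, ν =>
      if (q.atom i).ground ν ∈ D.facts then
        D.prob ((q.atom i).ground ν).1 ((q.atom i).ground ν).2
      else 0
  | .proj y P, ν =>
      1 - ∏ μ ∈ Fintype.piFinset fun _ : {x : V // x ∈ y} => D.adom,
        (1 - q.score D P (override ν y μ))
  | .join P, ν => ∏ j, q.score D (P j) ν

end

end SafeDissociation

namespace SafeDissociation

noncomputable section

open scoped Classical

universe u v w z

variable {σ : Vocab.{u, v}} {V : Type w} {C : Type z} {m : ℕ}

/-! A plan is a tree, and all that matters about it is the set `A i` of variables that are projected
away on the path from the root to each leaf `i`. `Plan.Adapted A ∅` says that the tree realizes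
prescribed sets `A i` and that different operands of a join share only variables that were projected
away further up. Both sides of the bijection are translated into this notion.

The tree can be rebuilt from `A`. At each node, the remaining variables common to all leaves have to
be projected away together; when there are none, the operands of the join are the connected
components of the leaves under the relation of sharing a remaining variable. Hence an adapted plan
is unique up to the order of operands (`Plan.Adapted.equiv`). It exists as soon as the sets of
leaves at which the variables occur form a laminar family (`Plan.exists_adapted`), and laminarity is
necessary (`Plan.Adapted.laminar`).

Let `A i` consist of the existential variables of the `i`-th atom of `q^Δ`, that is `extendedVars`.
The plans for `q` with dissociation `Δ` are exactly the plans adapted to `A`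
(`isPlan_and_dissociationOf_iff`). A safe plan is one whose own dissociation is empty, so the safe
plans for `q^Δ` are the plans adapted to the same `A` (`dissociate_isPlan_and_safePlan_iff`).
Laminarity of `A` is the hierarchy condition on `q^Δ`. This gives the bijection and the uniqueness
of the safe plan.

For the scores, extensional evaluation of a safe plan is exact because every operator combines
independent events (`SelfJoinFree.probOf_holdsOn`): operands of a join use different relations, and
a projected variable occurs in every atom below, so different values for it involve different facts.
Finally the plan has the same score on `D` and on `D^Δ` (`score_dissociate`), because an added
column is only read at values in the active domain, where the copy carries the original probability.
-/

theorem nodup_sum_univ {ι α : Type*} [Fintype ι] {f : ι → Multiset α} :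
    (∑ j, f j).Nodup ↔ (∀ j, (f j).Nodup) ∧ ∀ j l, j ≠ l → ∀ a ∈ f j, a ∉ f l := by
  have h : (∑ j, f j) = Finset.univ.val.bind f := rfl
  rw [h, Multiset.nodup_bind]
  refine and_congr (by simp) ⟨fun h j l hjl a ha ha' => ?_, fun h => ?_⟩
  · exact Multiset.disjoint_left.1 (h.forall (Finset.mem_univ j) (Finset.mem_univ l) hjl) ha ha'
  · exact Multiset.Nodup.pairwise (fun j _ l _ hjl => Multiset.disjoint_left.2 fun {a} ha =>
      h j l hjl a ha) Finset.univ.nodup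

/-! ### Plans adapted to an assignment of variable sets to the leaves -/

namespace Plan

/-- `P.Adapted A H`: when the variables in `H` have been projected away above `P`, the variables
projected away above each leaf `i` of `P` are exactly those of `A i`, and the operands of a join
share no further variables. -/
def Adapted (A : Fin m → Finset V) : Plan m V → Finset V → Prop
  | .atom i, H => A i = H
  | .proj y P, H => y.Nonempty ∧ Disjoint y H ∧ ¬ P.IsProj ∧ P.Adapted A (H ∪ y)
  | @Plan.join _ _ k P, H => 2 ≤ k ∧ (∀ j, ¬ (P j).IsJoin ∧ (P j).Adapted A H) ∧
      ∀ j l, j ≠ l → ∀ i ∈ (P j).leaves, ∀ i' ∈ (P l).leaves, i ≠ i' ∧ A i ∩ A i' ⊆ H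

variable {A : Fin m → Finset V} {P Q : Plan m V} {H : Finset V}

theorem mem_leaves_join {k : ℕ} {P : Fin k → Plan m V} {i : Fin m} :
    i ∈ (Plan.join P).leaves ↔ ∃ j, i ∈ (P j).leaves := by
  simp [leaves, Multiset.mem_sum]

theorem Adapted.exists_leaf (h : P.Adapted A H) : ∃ i, i ∈ P.leaves := by
  induction P generalizing H with
  | atom i => exact ⟨i, by simp [leaves]⟩
  | proj y P ih => exact ih h.2.2.2
  | join P ih =>
    obtain ⟨i, hi⟩ := ih ⟨0, by have := h.1; omega⟩ (h.2.1 _).2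
    exact ⟨i, mem_leaves_join.2 ⟨_, hi⟩⟩

theorem Adapted.subset (h : P.Adapted A H) {i : Fin m} (hi : i ∈ P.leaves) : H ⊆ A i := by
  induction P generalizing H with
  | atom i' =>
    obtain rfl : i = i' := by simpa [leaves] using hi
    exact (show A i = H from h).ge
  | proj y P ih => exact Finset.subset_union_left.trans (ih h.2.2.2 hi)
  | join P ih =>
    obtain ⟨j, hj⟩ := mem_leaves_join.1 hi
    exact ih j (h.2.1 j).2 hj

theorem Adapted.congr {A' : Fin m → Finset V} (h : P.Adapted A H)
    (hA : ∀ i ∈ P.leaves, A i = A' i) : P.Adapted A' H := by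
  induction P generalizing H with
  | atom i => exact (hA i (by simp [leaves])).symm.trans h
  | proj y P ih => exact ⟨h.1, h.2.1, h.2.2.1, ih h.2.2.2 hA⟩
  | join P ih =>
    refine ⟨h.1, fun j => ⟨(h.2.1 j).1, ih j (h.2.1 j).2 fun i hi =>
      hA i (mem_leaves_join.2 ⟨j, hi⟩)⟩, fun j l hjl i hi i' hi' => ?_⟩
    rw [← hA i (mem_leaves_join.2 ⟨j, hi⟩), ← hA i' (mem_leaves_join.2 ⟨l, hi'⟩)]
    exact h.2.2 j l hjl i hi i' hi'

theorem Equiv.leaves_eq (h : P.Equiv Q) : P.leaves = Q.leaves := by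
  induction h with
  | atom i => rfl
  | proj y _ ih => exact ih
  | join P P' π _ ih =>
    simp only [leaves]
    rw [← Equiv.sum_comp π fun j => (P' j).leaves]
    exact Finset.sum_congr rfl fun j _ => ih j

theorem Equiv.isProj_iff (h : P.Equiv Q) : P.IsProj ↔ Q.IsProj := by
  cases h <;> simp [IsProj]

theorem Equiv.isJoin_iff (h : P.Equiv Q) : P.IsJoin ↔ Q.IsJoin := by
  cases h <;> simp [IsJoin]

theorem Equiv.adapted (h : P.Equiv Q) (hP : P.Adapted A H) : Q.Adapted A H := by
  induction h generalizing H with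
  | atom i => exact hP
  | proj y h ih => exact ⟨hP.1, hP.2.1, h.isProj_iff.not.1 hP.2.2.1, ih hP.2.2.2⟩
  | join P P' π h ih =>
    refine ⟨hP.1, fun j => ?_, fun j l hjl i hi i' hi' => ?_⟩
    · obtain ⟨j, rfl⟩ := π.surjective j
      exact ⟨(h j).isJoin_iff.not.1 (hP.2.1 j).1, ih j (hP.2.1 j).2⟩
    · obtain ⟨j, rfl⟩ := π.surjective j
      obtain ⟨l, rfl⟩ := π.surjective l
      rw [← (h j).leaves_eq] at hi
      rw [← (h l).leaves_eq] at hi'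
      exact hP.2.2 j l (fun e => hjl (e ▸ rfl)) i hi i' hi'

/-! ### Uniqueness of the adapted plan -/

/-- Two leaves of an operand of a join either coincide or share a variable outside of `H`. -/
theorem Adapted.eq_or_exists_common (h : P.Adapted A H) (hP : ¬ P.IsJoin) {i i' : Fin m}
    (hi : i ∈ P.leaves) (hi' : i' ∈ P.leaves) :
    i = i' ∨ ∃ x ∉ H, x ∈ A i ∧ x ∈ A i' := by
  cases P with
  | atom l =>
    simp only [leaves, Multiset.mem_singleton] at hi hi'
    exact .inl (hi.trans hi'.symm)
  | proj y P =>
    obtain ⟨x, hx⟩ := h.1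
    have hxu : x ∈ H ∪ y := Finset.mem_union_right _ hx
    exact .inr ⟨x, Finset.disjoint_left.1 h.2.1 hx, h.2.2.2.subset hi hxu, h.2.2.2.subset hi' hxu⟩
  | join P => exact (hP trivial).elim

/-- A variable that occurs at all leaves of a plan which is not a projection is in `H`. -/
theorem Adapted.mem_of_forall_mem (h : P.Adapted A H) (hP : ¬ P.IsProj) {x : V}
    (hx : ∀ i ∈ P.leaves, x ∈ A i) : x ∈ H := by
  cases P with
  | atom i => exact (show A i = H from h) ▸ hx i (by simp [leaves])
  | proj y P => exact (hP trivial).elim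
  | @join k P =>
    have hk := h.1
    let j : Fin k := ⟨0, by omega⟩
    let l : Fin k := ⟨1, by omega⟩
    obtain ⟨i, hi⟩ := (h.2.1 j).2.exists_leaf
    obtain ⟨i', hi'⟩ := (h.2.1 l).2.exists_leaf
    exact (h.2.2 j l (by simp [j, l]) i hi i' hi').2 (Finset.mem_inter.2
      ⟨hx i (mem_leaves_join.2 ⟨j, hi⟩), hx i' (mem_leaves_join.2 ⟨l, hi'⟩)⟩)

/-- The leaves of an operand of one join are leaves of a single operand of the other. -/
theorem Adapted.exists_operand {k k' : ℕ} {P : Fin k → Plan m V} {P' : Fin k' → Plan m V}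
    (h : (Plan.join P).Adapted A H) (h' : (Plan.join P').Adapted A H)
    (hl : ∀ i, i ∈ (Plan.join P).leaves ↔ i ∈ (Plan.join P').leaves) (j : Fin k) :
    ∃ l, ∀ i ∈ (P j).leaves, i ∈ (P' l).leaves := by
  obtain ⟨i, hi⟩ := (h.2.1 j).2.exists_leaf
  obtain ⟨l, hil⟩ := mem_leaves_join.1 ((hl i).1 (mem_leaves_join.2 ⟨j, hi⟩))
  refine ⟨l, fun i' hi' => ?_⟩
  obtain ⟨l', hil'⟩ := mem_leaves_join.1 ((hl i').1 (mem_leaves_join.2 ⟨j, hi'⟩))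
  by_contra hn
  have hne : l ≠ l' := by rintro rfl; exact hn hil'
  obtain ⟨h1, h2⟩ := h'.2.2 l l' hne i hil i' hil'
  -- Leaves in different operands of the second join share nothing outside `H`, but within `P j`,
  -- which is not itself a join, distinct leaves do share such a variable.
  obtain rfl | ⟨x, hxH, hx, hx'⟩ := (h.2.1 j).2.eq_or_exists_common (h.2.1 j).1 hi hi'
  · exact h1 rfl
  · exact hxH (h2 (Finset.mem_inter.2 ⟨hx, hx'⟩))

theorem Adapted.operand_unique {k : ℕ} {P : Fin k → Plan m V} (h : (Plan.join P).Adapted A H)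
    {j l : Fin k} {i : Fin m} (hj : i ∈ (P j).leaves) (hl : i ∈ (P l).leaves) : j = l := by
  by_contra hne
  exact (h.2.2 j l hne i hj i hl).1 rfl

/-- An adapted plan is determined by its leaves, up to the order of the operands of joins. -/
theorem Adapted.equiv (h : P.Adapted A H) (hQ : Q.Adapted A H)
    (hl : ∀ i, i ∈ P.leaves ↔ i ∈ Q.leaves) : P.Equiv Q := by
  induction P generalizing Q H with
  | atom i =>
    have hx : ∀ {x}, (∀ i ∈ Q.leaves, x ∈ A i) → x ∈ H := fun hx =>
      (show A i = H from h) ▸ hx i ((hl i).1 (by simp [leaves]))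
    cases Q with
    | atom i' =>
      obtain rfl : i = i' := by simpa [leaves] using hl i
      exact .atom i
    | proj y Q =>
      obtain ⟨x, hxy⟩ := hQ.1
      exact (Finset.disjoint_left.1 hQ.2.1 hxy
        (hx fun i hi => hQ.2.2.2.subset hi (Finset.mem_union_right _ hxy))).elim
    | @join k Q =>
      have hk := hQ.1
      have hmem : ∀ j, i ∈ (Q j).leaves := fun j => by
        obtain ⟨i', hi'⟩ := (hQ.2.1 j).2.exists_leaf
        have := (hl i').2 (mem_leaves_join.2 ⟨j, hi'⟩)
        simp only [leaves, Multiset.mem_singleton] at this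
        exact this ▸ hi'
      have := hQ.operand_unique (hmem ⟨0, by omega⟩) (hmem ⟨1, by omega⟩)
      simp at this
  | proj y P ih =>
    have hy : ∀ x ∈ y, (∀ i ∈ Q.leaves, x ∈ A i) ∧ x ∉ H := fun x hx =>
      ⟨fun i hi => h.2.2.2.subset ((hl i).2 hi) (Finset.mem_union_right _ hx),
        Finset.disjoint_left.1 h.2.1 hx⟩
    by_cases hQp : Q.IsProj
    · cases Q with
      | proj y' Q =>
        -- Neither operand is a projection, so each of `y` and `y'` is the full set of variables
        -- outside `H` common to all leaves.
        have hy' : y' = y := by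
          ext x
          constructor <;> intro hx
          · refine (Finset.mem_union.1 (h.2.2.2.mem_of_forall_mem h.2.2.1 fun i hi =>
              hQ.2.2.2.subset ((hl i).1 hi) (Finset.mem_union_right _ hx))).resolve_left ?_
            exact Finset.disjoint_left.1 hQ.2.1 hx
          · exact (Finset.mem_union.1 (hQ.2.2.2.mem_of_forall_mem hQ.2.2.1
              (hy x hx).1)).resolve_left (hy x hx).2
        subst hy'
        exact .proj _ (ih h.2.2.2 hQ.2.2.2 hl)
      | _ => exact hQp.elim
    · obtain ⟨x, hx⟩ := h.1
      exact ((hy x hx).2 (hQ.mem_of_forall_mem hQp (hy x hx).1)).elim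
  | @join k P ih =>
    cases Q with
    | atom i =>
      have hk := h.1
      have hmem : ∀ j, i ∈ (P j).leaves := fun j => by
        obtain ⟨i', hi'⟩ := (h.2.1 j).2.exists_leaf
        have := (hl i').1 (mem_leaves_join.2 ⟨j, hi'⟩)
        simp only [leaves, Multiset.mem_singleton] at this
        exact this ▸ hi'
      have := h.operand_unique (hmem ⟨0, by omega⟩) (hmem ⟨1, by omega⟩)
      simp at this
    | proj y Q =>
      obtain ⟨x, hx⟩ := hQ.1
      exact (Finset.disjoint_left.1 hQ.2.1 hx (h.mem_of_forall_mem not_false fun i hi =>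
        hQ.2.2.2.subset ((hl i).1 hi) (Finset.mem_union_right _ hx))).elim
    | @join k' Q =>
      choose f hf using h.exists_operand hQ hl
      choose g hg using hQ.exists_operand h fun i => (hl i).symm
      have hgf : ∀ j, g (f j) = j := fun j => by
        obtain ⟨i, hi⟩ := (h.2.1 j).2.exists_leaf
        exact h.operand_unique (hg _ i (hf _ i hi)) hi
      have hfg : ∀ l, f (g l) = l := fun l => by
        obtain ⟨i, hi⟩ := (hQ.2.1 l).2.exists_leaf
        exact hQ.operand_unique (hf _ i (hg _ i hi)) hi
      let π : Fin k ≃ Fin k' := ⟨f, g, hgf, hfg⟩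
      obtain rfl : k = k' := by simpa using Fintype.card_congr π
      refine .join P Q π fun j => ih j (h.2.1 j).2 (hQ.2.1 (f j)).2 fun i => ⟨hf j i, fun hi => ?_⟩
      have := hg (f j) i hi
      rwa [hgf] at this

/-! ### Laminarity and existence of the adapted plan -/

/-- The sets of leaves of an adapted plan at which the variables occur form a laminar family. -/
theorem Adapted.laminar (h : P.Adapted A H) {x y : V} (hx : x ∉ H) (hy : y ∉ H) :
    (∀ i ∈ P.leaves, x ∈ A i → y ∈ A i) ∨ (∀ i ∈ P.leaves, x ∈ A i → y ∉ A i) ∨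
      ∀ i ∈ P.leaves, y ∈ A i → x ∈ A i := by
  induction P generalizing H with
  | atom i =>
    refine .inl fun l hl hxl => (hx ?_).elim
    obtain rfl : l = i := by simpa [leaves] using hl
    exact (show A l = H from h) ▸ hxl
  | proj z P ih =>
    by_cases hxz : x ∈ z
    · exact .inr (.inr fun i hi _ => h.2.2.2.subset hi (Finset.mem_union_right _ hxz))
    by_cases hyz : y ∈ z
    · exact .inl fun i hi _ => h.2.2.2.subset hi (Finset.mem_union_right _ hyz)
    exact ih h.2.2.2 (by simp [hx, hxz]) (by simp [hy, hyz])
  | @join k P ih =>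
    by_cases hc : ∃ i ∈ (Plan.join P).leaves, x ∈ A i ∧ y ∈ A i
    · obtain ⟨i, hi, hxi, hyi⟩ := hc
      obtain ⟨j, hj⟩ := mem_leaves_join.1 hi
      -- A variable outside `H` that occurs at a leaf of operand `j` occurs in no other operand, so
      -- a comparison of `x` and `y` inside `P j` is already a comparison over the whole join.
      have key : ∀ {t}, t ∉ H → t ∈ A i → ∀ l ∈ (Plan.join P).leaves, t ∈ A l →
          l ∈ (P j).leaves := by
        intro t ht hti l hl htl
        obtain ⟨j', hj'⟩ := mem_leaves_join.1 hl
        by_cases hjj : j = j'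
        · exact hjj ▸ hj'
        · exact (ht ((h.2.2 j j' hjj i hj l hj').2 (Finset.mem_inter.2 ⟨hti, htl⟩))).elim
      obtain h1 | h1 | h1 := ih j (h.2.1 j).2 hx hy
      · exact .inl fun l hl hxl => h1 l (key hx hxi l hl hxl) hxl
      · exact (h1 i hj hxi hyi).elim
      · exact .inr (.inr fun l hl hyl => h1 l (key hy hyi l hl hyl) hyl)
    · push Not at hc
      exact .inr (.inl hc)

/-- A laminar assignment of variable sets has an adapted plan on every nonempty set of leaves. -/
theorem exists_adapted (A : Fin m → Finset V)
    (hA : ∀ x y, (∀ i, x ∈ A i → y ∈ A i) ∨ (∀ i, x ∈ A i → y ∉ A i) ∨ ∀ i, y ∈ A i → x ∈ A i)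
    (S : Finset (Fin m)) (hS : S.Nonempty) (H : Finset V) (hH : ∀ i ∈ S, H ⊆ A i) :
    ∃ P : Plan m V, P.Adapted A H ∧ P.leaves = S.val := by
  -- A projection keeps `S` and shrinks the set of remaining variables; a join passes to strictly
  -- smaller sets of leaves without enlarging that set.
  induction hn : S.card + (S.biUnion A \ H).card using Nat.strong_induction_on
    generalizing S H with
  | _ n ih =>
  subst hn
  let r : Fin m → Fin m → Prop := fun i i' => i = i' ∨ ∃ x ∉ H, x ∈ A i ∧ x ∈ A i'
  have hrs : ∀ {i i'}, r i i' → r i' i := by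
    rintro i i' (h | ⟨x, hx, h1, h2⟩)
    · exact .inl h.symm
    · exact .inr ⟨x, hx, h2, h1⟩
  have hrt : ∀ {i i' i''}, r i i' → r i' i'' → r i i'' := by
    rintro i i' i'' (rfl | ⟨x, hx, h1, h2⟩) (rfl | ⟨y, hy, h3, h4⟩)
    · exact .inl rfl
    · exact .inr ⟨y, hy, h3, h4⟩
    · exact .inr ⟨x, hx, h1, h2⟩
    -- Both `x` and `y` occur at `i'`, so by laminarity one of them occurs wherever the other does,
    -- and it links `i` to `i''`. Only here does transitivity need laminarity.
    · obtain h | h | h := hA x y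
      · exact .inr ⟨y, hy, h _ h1, h4⟩
      · exact (h _ h2 h3).elim
      · exact .inr ⟨x, hx, h1, h _ h4⟩
  by_cases hconn : ∀ i ∈ S, ∀ i' ∈ S, r i i'
  · by_cases hY : ∃ x ∉ H, ∀ i ∈ S, x ∈ A i
    · obtain ⟨x, hxH, hx⟩ := hY
      let Y := ((S.biUnion A).filter fun x => ∀ i ∈ S, x ∈ A i) \ H
      have hY : ∀ {x}, x ∈ Y ↔ (∀ i ∈ S, x ∈ A i) ∧ x ∉ H := by
        intro x
        simp only [Y, Finset.mem_sdiff, Finset.mem_filter, Finset.mem_biUnion]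
        refine ⟨fun h => ⟨h.1.2, h.2⟩, fun h => ⟨⟨?_, h.1⟩, h.2⟩⟩
        exact ⟨hS.choose, hS.choose_spec, h.1 _ hS.choose_spec⟩
      have hxY : x ∈ Y := hY.2 ⟨hx, hxH⟩
      obtain ⟨P, hP, hPl⟩ := ih (S.card + (S.biUnion A \ (H ∪ Y)).card) (by
        refine Nat.add_lt_add_left (Finset.card_lt_card (Finset.ssubset_iff_of_subset
          (Finset.sdiff_subset_sdiff le_rfl Finset.subset_union_left) |>.2 ⟨x, ?_, ?_⟩)) _
        · exact Finset.mem_sdiff.2 ⟨Finset.mem_biUnion.2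
            ⟨_, hS.choose_spec, hx _ hS.choose_spec⟩, hxH⟩
        · simp [hxY]) S hS (H ∪ Y)
        (fun i hi => Finset.union_subset (hH i hi) fun x hx => (hY.1 hx).1 i hi) rfl
      refine ⟨.proj Y P, ⟨⟨x, hxY⟩, Finset.disjoint_left.2 fun x hx => (hY.1 hx).2, ?_, hP⟩, hPl⟩
      -- `Y` is maximal: a variable projected by a second projection directly below would also be
      -- common to all leaves, hence already in `Y`.
      intro hproj
      cases P with
      | proj y P =>
        obtain ⟨z, hz⟩ := hP.1
        have hzn := Finset.disjoint_left.1 hP.2.1 hz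
        refine hzn (Finset.mem_union_right _ (hY.2 ⟨fun i hi => ?_, fun h =>
          hzn (Finset.mem_union_left _ h)⟩))
        refine hP.2.2.2.subset (i := i) ?_ (Finset.mem_union_right _ hz)
        have : i ∈ (Plan.proj y P).leaves := by rw [hPl]; exact hi
        exact this
      | _ => exact hproj.elim
    · obtain ⟨i, hi⟩ := hS
      have hSi : S = {i} := by
        by_contra hne
        obtain ⟨i', hi', hii'⟩ : ∃ i' ∈ S, i' ≠ i := by
          by_contra! hc
          exact hne (Finset.eq_singleton_iff_unique_mem.2 ⟨hi, hc⟩)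
        obtain ⟨x₀, hx₀H, hx₀, -⟩ := (hconn i hi i' hi').resolve_left hii'.symm
        -- Among the remaining variables of `i`, take one that occurs at the most leaves. If it
        -- missed a leaf `l`, a variable shared by `i` and `l` would, by laminarity, occur at
        -- strictly more leaves; so it is common to all of `S`, against `hY`.
        obtain ⟨x, hx, hmax⟩ := Finset.exists_max_image (A i \ H)
          (fun x => (S.filter fun l => x ∈ A l).card) ⟨x₀, Finset.mem_sdiff.2 ⟨hx₀, hx₀H⟩⟩
        rw [Finset.mem_sdiff] at hx
        refine hY ⟨x, hx.2, fun l hl => ?_⟩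
        by_contra hxl
        obtain rfl | ⟨y, hyH, hyi, hyl⟩ := hconn i hi l hl
        · exact hxl hx.1
        obtain h | h | h := hA x y
        · refine absurd (hmax y (Finset.mem_sdiff.2 ⟨hyi, hyH⟩)) (not_le.2 (Finset.card_lt_card ?_))
          refine (Finset.ssubset_iff_of_subset fun t ht => ?_).2 ⟨l, ?_, ?_⟩
          · rw [Finset.mem_filter] at ht ⊢
            exact ⟨ht.1, h t ht.2⟩
          · exact Finset.mem_filter.2 ⟨hl, hyl⟩
          · simp [hxl]
        · exact h i hx.1 hyi
        · exact hxl (h l hyl)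
      subst hSi
      refine ⟨.atom i, ?_, rfl⟩
      refine (Finset.Subset.antisymm (hH i hi) fun x hx => ?_).symm
      by_contra hxH
      exact hY ⟨x, hxH, by simpa using hx⟩
  · push Not at hconn
    obtain ⟨i₀, hi₀, i₁, hi₁, h01⟩ := hconn
    let cls : Fin m → Finset (Fin m) := fun i => S.filter (r i)
    have hcls : ∀ {i i'}, i ∈ S → (cls i = cls i' ↔ r i' i) := by
      intro i i' hi
      constructor
      · intro h
        have : i ∈ cls i := Finset.mem_filter.2 ⟨hi, .inl rfl⟩
        rw [h] at this
        exact (Finset.mem_filter.1 this).2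
      · intro h
        ext l
        simp only [cls, Finset.mem_filter]
        exact and_congr_right fun _ => ⟨hrt h, hrt (hrs h)⟩
    -- The connected components of `S` become the operands; numbering the components themselves, not
    -- their elements, makes each appear once.
    let T := S.image cls
    let f : Fin T.card ≃ T := T.equivFin.symm
    have hT : ∀ j, ∃ i ∈ S, cls i = (f j).1 := fun j => Finset.mem_image.1 (f j).2
    choose c hcS hc using hT
    have hex : ∀ j, ∃ P : Plan m V, P.Adapted A H ∧ P.leaves = (cls (c j)).val := by
      intro j
      have hlt : (cls (c j)).card < S.card := by
        refine Finset.card_lt_card ((Finset.ssubset_iff_of_subset (Finset.filter_subset _ _)).2 ?_)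
        by_cases h : r (c j) i₀
        · exact ⟨i₁, hi₁, fun h' => h01 (hrt (hrs h) (Finset.mem_filter.1 h').2)⟩
        · exact ⟨i₀, hi₀, fun h' => h (Finset.mem_filter.1 h').2⟩
      refine ih ((cls (c j)).card + ((cls (c j)).biUnion A \ H).card) ?_ _
        ⟨c j, Finset.mem_filter.2 ⟨hcS j, .inl rfl⟩⟩ H
        (fun i hi => hH i (Finset.mem_filter.1 hi).1) rfl
      refine Nat.add_lt_add_of_lt_of_le hlt (Finset.card_le_card
        (Finset.sdiff_subset_sdiff (Finset.biUnion_subset_biUnion_of_subset_left _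
          (Finset.filter_subset _ _)) le_rfl))
    choose P hP hPl using hex
    have hmem : ∀ {j i}, i ∈ (P j).leaves ↔ i ∈ S ∧ r (c j) i := by
      intro j i
      rw [hPl, Finset.mem_val, Finset.mem_filter]
    have hdis : ∀ {j l i}, r (c j) i → r (c l) i → j = l := by
      intro j l i h1 h2
      apply f.injective
      apply Subtype.ext
      rw [← hc, ← hc, hcls (hcS j)]
      exact hrt h2 (hrs h1)
    refine ⟨.join P, ⟨?_, fun j => ⟨?_, hP j⟩, ?_⟩, ?_⟩
    · refine Finset.one_lt_card.2 ⟨cls i₀, Finset.mem_image_of_mem _ hi₀, cls i₁,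
        Finset.mem_image_of_mem _ hi₁, fun h => h01 (hrs ((hcls hi₀).1 h))⟩
    -- A component is connected by variables outside `H`, while two operands of a join share none,
    -- so no operand is itself a join.
    · intro hj
      have hPj := hP j
      have hm := fun i => hmem (j := j) (i := i)
      revert hj hPj hm
      cases P j with
      | @join k Q =>
        intro _ hQ hm
        have hk := hQ.1
        obtain ⟨i, hi⟩ := (hQ.2.1 ⟨0, by omega⟩).2.exists_leaf
        obtain ⟨i', hi'⟩ := (hQ.2.1 ⟨1, by omega⟩).2.exists_leaf
        obtain ⟨h1, h2⟩ := hQ.2.2 _ _ (by simp) i hi i' hi'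
        obtain h | ⟨x, hx, h3, h4⟩ := hrt (hrs ((hm i).1 (mem_leaves_join.2 ⟨_, hi⟩)).2)
          ((hm i').1 (mem_leaves_join.2 ⟨_, hi'⟩)).2
        · exact h1 h
        · exact hx (h2 (Finset.mem_inter.2 ⟨h3, h4⟩))
      | _ => exact fun h => h.elim
    · intro j l hjl i hi i' hi'
      have hn : ¬ r i i' := fun h => hjl (hdis (hrt (hmem.1 hi).2 h) (hmem.1 hi').2)
      refine ⟨fun h => hn (.inl h), fun x hx => ?_⟩
      rw [Finset.mem_inter] at hx
      by_contra hxH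
      exact hn (.inr ⟨x, hxH, hx⟩)
    · refine (Multiset.Nodup.ext ?_ S.nodup).2 fun i => ?_
      · refine nodup_sum_univ.2 ⟨fun j => hPl j ▸ (cls (c j)).nodup, fun j l hjl i hi hi' =>
          hjl (hdis (hmem.1 hi).2 (hmem.1 hi').2)⟩
      · rw [mem_leaves_join, Finset.mem_val]
        refine ⟨fun ⟨j, hj⟩ => (hmem.1 hj).1, fun hi => ?_⟩
        obtain ⟨j, hj⟩ := f.surjective ⟨cls i, Finset.mem_image_of_mem _ hi⟩
        refine ⟨j, hmem.2 ⟨hi, (hcls hi).1 ?_⟩⟩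
        exact ((hc j).trans (congrArg Subtype.val hj)).symm

end Plan

/-! ### Adapted plans and query plans -/

namespace Plan

variable {A : Fin m → Finset V} {P : Plan m V} {H : Finset V}

theorem mem_projected_join {k : ℕ} {P : Fin k → Plan m V} {x : V} :
    x ∈ (Plan.join P).projected ↔ ∃ j, x ∈ (P j).projected := by
  simp [projected, Multiset.mem_sum]

theorem Adapted.mem_projected (h : P.Adapted A H) {x : V} (hx : x ∈ P.projected) :
    x ∉ H ∧ ∃ i ∈ P.leaves, x ∈ A i := by
  induction P generalizing H with
  | atom i => simp [projected] at hx
  | proj y P ih =>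
    simp only [projected, Multiset.mem_add, Finset.mem_val] at hx
    obtain hx | hx := hx
    · obtain ⟨i, hi⟩ := h.2.2.2.exists_leaf
      exact ⟨Finset.disjoint_left.1 h.2.1 hx, i, hi,
        h.2.2.2.subset hi (Finset.mem_union_right _ hx)⟩
    · obtain ⟨h1, h2⟩ := ih h.2.2.2 hx
      exact ⟨fun h => h1 (Finset.mem_union_left _ h), h2⟩
  | join P ih =>
    obtain ⟨j, hj⟩ := mem_projected_join.1 hx
    obtain ⟨h1, i, hi, h2⟩ := ih j (h.2.1 j).2 hj
    exact ⟨h1, i, mem_leaves_join.2 ⟨j, hi⟩, h2⟩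

/-- A variable projected away in two operands would be listed at leaves of both, hence lie in `H`;
but nothing in `H` is projected away again. -/
theorem Adapted.nodup_projected (h : P.Adapted A H) : P.projected.Nodup := by
  induction P generalizing H with
  | atom i => exact Multiset.nodup_zero
  | proj y P ih =>
    refine Multiset.nodup_add.2 ⟨y.nodup, ih h.2.2.2, Multiset.disjoint_left.2 fun {x} hx hx' => ?_⟩
    exact (h.2.2.2.mem_projected hx').1 (Finset.mem_union_right _ hx)
  | join P ih =>
    refine nodup_sum_univ.2 ⟨fun j => ih j (h.2.1 j).2, fun j l hjl x hx hx' => ?_⟩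
    obtain ⟨h1, i, hi, h2⟩ := (h.2.1 j).2.mem_projected hx
    obtain ⟨-, i', hi', h3⟩ := (h.2.1 l).2.mem_projected hx'
    exact h1 ((h.2.2 j l hjl i hi i' hi').2 (Finset.mem_inter.2 ⟨h2, h3⟩))

end Plan

namespace CQ

open Plan

variable {q : CQ σ V C m} {A : Fin m → Finset V} {P : Plan m V} {H : Finset V}

theorem mem_headVars_join {k : ℕ} {P : Fin k → Plan m V} {x : V} :
    x ∈ q.headVars (.join P) ↔ ∃ j, x ∈ q.headVars (P j) := by
  simp [headVars]

theorem mem_dissociationOf_join {k : ℕ} {P : Fin k → Plan m V} {i : Fin m} {x : V} :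
    x ∈ q.dissociationOf (.join P) i ↔ ∃ j, i ∈ (P j).leaves ∧ (x ∈ q.dissociationOf (P j) i ∨
      (x ∈ q.headVars (.join P) ∧ x ∉ q.headVars (P j)) ∧ x ∉ q.head) := by
  simp only [dissociationOf, Finset.mem_biUnion, Finset.mem_univ, true_and]
  refine exists_congr fun j => ?_
  split_ifs with h <;> simp [h]

/-- `A` lists, at every leaf, at least the variables of the subgoal that are not head variables. -/
structure Covers (q : CQ σ V C m) (A : Fin m → Finset V) : Prop where
  vars_subset : ∀ i, ∀ x ∈ (q.atom i).vars, x ∉ q.head → x ∈ A i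
  notMem_head : ∀ i, ∀ x ∈ A i, x ∉ q.head

/-- Every variable that is listed at a leaf of `P` and does not belong to `H` occurs in a subgoal
of `P`. -/
def LocallyCovered (q : CQ σ V C m) (A : Fin m → Finset V) (P : Plan m V) (H : Finset V) : Prop :=
  ∀ i ∈ P.leaves, ∀ x ∈ A i, x ∉ H → ∃ i' ∈ P.leaves, x ∈ (q.atom i').vars

theorem LocallyCovered.proj {y : Finset V} (h : q.LocallyCovered A (.proj y P) H) :
    q.LocallyCovered A P (H ∪ y) :=
  fun i hi x hx hxH => h i hi x hx fun h => hxH (Finset.mem_union_left _ h)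

/-- The occurrence of the variable in a subgoal cannot fall into another operand, since operands
share only variables of `H`. -/
theorem LocallyCovered.operand {k : ℕ} {P : Fin k → Plan m V}
    (h : q.LocallyCovered A (.join P) H) (hA : q.Covers A) (hP : (Plan.join P).Adapted A H)
    (j : Fin k) : q.LocallyCovered A (P j) H := by
  intro i hi x hx hxH
  obtain ⟨i', hi', hx'⟩ := h i (mem_leaves_join.2 ⟨j, hi⟩) x hx hxH
  obtain ⟨l, hl⟩ := mem_leaves_join.1 hi'
  by_cases hjl : j = l
  · exact ⟨i', hjl ▸ hl, hx'⟩
  · exact (hxH ((hP.2.2 j l hjl i hi i' hl).2 (Finset.mem_inter.2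
      ⟨hx, hA.vars_subset _ _ hx' (hA.notMem_head _ _ hx)⟩))).elim

/-- An existential variable of a subgoal below is projected away either inside `P` or above it, and
`H` collects those projected above. -/
theorem mem_headVars_of_adapted (hA : q.Covers A) (h : P.Adapted A H) {x : V} :
    x ∈ q.headVars P ↔ (∃ i ∈ P.leaves, x ∈ (q.atom i).vars) ∧ (x ∈ H ∨ x ∈ q.head) := by
  induction P generalizing H with
  | atom i =>
    simp only [headVars, leaves, Multiset.mem_singleton, exists_eq_left]
    refine (and_iff_left_of_imp fun hx => ?_).symm
    by_cases hxh : x ∈ q.head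
    · exact .inr hxh
    · exact .inl ((show A i = H from h) ▸ hA.vars_subset i x hx hxh)
  | proj y P ih =>
    simp only [headVars, Finset.mem_sdiff, ih h.2.2.2, Finset.mem_union, leaves]
    obtain ⟨i, hi⟩ := h.2.2.2.exists_leaf
    have hy : x ∈ y → x ∉ H ∧ x ∉ q.head := fun hx => ⟨Finset.disjoint_left.1 h.2.1 hx,
      hA.notMem_head i x (h.2.2.2.subset hi (Finset.mem_union_right _ hx))⟩
    tauto
  | join P ih =>
    simp only [mem_headVars_join, mem_leaves_join, fun j => ih j (h.2.1 j).2]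
    constructor
    · rintro ⟨j, ⟨i, hi, hx⟩, hxH⟩
      exact ⟨⟨i, ⟨j, hi⟩, hx⟩, hxH⟩
    · rintro ⟨⟨i, ⟨j, hi⟩, hx⟩, hxH⟩
      exact ⟨j, ⟨i, hi, hx⟩, hxH⟩

/-- Adaptedness only lists `y` at the leaves, possibly as added variables. Local coverage supplies a
subgoal below in which each variable of `y` really occurs, so there is something to project away. -/
theorem subset_headVars_of_adapted_proj {y : Finset V} (hA : q.Covers A)
    (h : (Plan.proj y P).Adapted A H) (hc : q.LocallyCovered A (.proj y P) H) :
    y ⊆ q.headVars P := by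
  intro x hx
  obtain ⟨i, hi⟩ := h.2.2.2.exists_leaf
  exact (mem_headVars_of_adapted hA h.2.2.2).2 ⟨hc i hi x (h.2.2.2.subset hi
    (Finset.mem_union_right _ hx)) (Finset.disjoint_left.1 h.2.1 hx),
    .inl (Finset.mem_union_right _ hx)⟩

theorem wellFormed_of_adapted (hA : q.Covers A) (h : P.Adapted A H)
    (hc : q.LocallyCovered A P H) : q.WellFormed P := by
  induction P generalizing H with
  | atom i => trivial
  | proj y P ih =>
    exact ⟨h.1, subset_headVars_of_adapted_proj hA h hc, h.2.2.1, ih h.2.2.2 hc.proj⟩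
  | join P ih =>
    exact ⟨h.1, fun j => ⟨(h.2.1 j).1, ih j (h.2.1 j).2 (hc.operand hA h j)⟩⟩

/-- The last alternative makes the induction work: a variable of `H` that does not occur in `P` at
all is added by a join above `P`, not within it. At the root `H` is empty and the alternative is
always true. -/
theorem mem_dissociationOf_of_adapted (hA : q.Covers A) (h : P.Adapted A H)
    (hc : q.LocallyCovered A P H) {i : Fin m} (hi : i ∈ P.leaves) {x : V} :
    x ∈ q.dissociationOf P i ↔
      x ∈ A i ∧ x ∉ (q.atom i).vars ∧ (x ∉ H ∨ x ∈ q.headVars P) := by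
  induction P generalizing H with
  | atom l =>
    obtain rfl : i = l := by simpa [leaves] using hi
    have hAi : A i = H := h
    simp only [dissociationOf, headVars, hAi, Finset.notMem_empty, false_iff]
    tauto
  | proj y P ih =>
    have hy := fun hx : x ∈ y => subset_headVars_of_adapted_proj hA h hc hx
    have hyH := fun hx : x ∈ y => Finset.disjoint_left.1 h.2.1 hx
    simp only [dissociationOf, headVars, ih h.2.2.2 hc.proj hi, Finset.mem_union,
      Finset.mem_sdiff]
    tauto
  | join P ih =>
    obtain ⟨j, hj⟩ := mem_leaves_join.1 hi
    have hI := ih j (h.2.1 j).2 (hc.operand hA h j) hj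
    have hhv := mem_headVars_of_adapted hA (h.2.1 j).2 (x := x)
    have hhv' := mem_headVars_of_adapted hA h (x := x)
    have hsub : x ∈ q.headVars (P j) → x ∈ q.headVars (.join P) := fun hx =>
      mem_headVars_join.2 ⟨j, hx⟩
    have hHA := fun hx : x ∈ H => h.subset hi hx
    have hAh := hA.notMem_head i x
    have hmem : x ∈ (q.atom i).vars → ∃ i ∈ (P j).leaves, x ∈ (q.atom i).vars :=
      fun hx => ⟨i, hj, hx⟩
    rw [mem_dissociationOf_join]
    -- The leaf `i` belongs to one operand only, so a single term of the union contributes.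
    trans x ∈ q.dissociationOf (P j) i ∨
      (x ∈ q.headVars (.join P) ∧ x ∉ q.headVars (P j)) ∧ x ∉ q.head
    · refine ⟨fun ⟨l, hl, hx⟩ => ?_, fun hx => ⟨j, hj, hx⟩⟩
      obtain rfl := h.operand_unique hl hj
      exact hx
    · rw [hI]
      constructor
      · rintro (⟨h1, h2, h3⟩ | ⟨⟨h1, h2⟩, h3⟩)
        · exact ⟨h1, h2, h3.imp_right hsub⟩
        · have hxH := (hhv'.1 h1).2.resolve_right h3
          exact ⟨hHA hxH, fun hx => h2 (hhv.2 ⟨hmem hx, .inl hxH⟩), .inr h1⟩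
      · rintro ⟨h1, h2, h3⟩
        by_cases hx : x ∈ q.headVars (P j)
        · exact .inl ⟨h1, h2, .inr hx⟩
        · exact h3.elim (fun h3 => .inl ⟨h1, h2, .inl h3⟩) fun h3 => .inr ⟨⟨h3, hx⟩, hAh h1⟩

/-- A plan that is adapted to `A` is a plan for `q` whose dissociation adds the variables that are
missing from `A`. -/
theorem isPlan_of_adapted (hA : q.Covers A) (hAv : ∀ i, A i ⊆ q.vars) (h : P.Adapted A ∅)
    (hl : P.leaves = (Finset.univ : Finset (Fin m)).val) :
    q.IsPlan P ∧ ∀ i, q.dissociationOf P i = A i \ (q.atom i).vars := by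
  have hmem : ∀ i, i ∈ P.leaves := fun i => by rw [hl]; exact Finset.mem_univ i
  have hc : q.LocallyCovered A P ∅ := fun i _ x hx _ => by
    obtain ⟨i', -, h'⟩ := Finset.mem_biUnion.1 (hAv i hx)
    exact ⟨i', hmem i', h'⟩
  refine ⟨⟨wellFormed_of_adapted hA h hc, hl, h.nodup_projected, fun x hx => ?_, ?_⟩, fun i => ?_⟩
  · obtain ⟨-, i, -, hi⟩ := h.mem_projected hx
    exact hA.notMem_head i x hi
  · ext x
    rw [mem_headVars_of_adapted hA h]
    refine ⟨fun hx => by simpa using hx.2, fun hx => ⟨?_, .inr hx⟩⟩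
    obtain ⟨i, -, hi⟩ := Finset.mem_biUnion.1 (q.head_subset hx)
    exact ⟨i, hmem i, hi⟩
  · ext x
    rw [mem_dissociationOf_of_adapted hA h hc (hmem i)]
    simp

/-! ### From query plans to adapted plans -/

theorem headVars_subset_vars (P : Plan m V) : q.headVars P ⊆ q.vars := by
  induction P with
  | atom i => exact Finset.subset_biUnion_of_mem (fun i => (q.atom i).vars) (Finset.mem_univ i)
  | proj y P ih => exact Finset.sdiff_subset.trans ih
  | join P ih => exact Finset.biUnion_subset.2 fun j _ => ih j

theorem WellFormed.projected_subset_vars (h : q.WellFormed P) {x : V} (hx : x ∈ P.projected) :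
    x ∈ q.vars := by
  induction P with
  | atom i => simp [projected] at hx
  | proj y P ih =>
    simp only [projected, Multiset.mem_add, Finset.mem_val] at hx
    exact hx.elim (fun hx => headVars_subset_vars P (h.2.1 hx)) (ih h.2.2.2)
  | join P ih =>
    obtain ⟨j, hj⟩ := mem_projected_join.1 hx
    exact ih j (h.2 j).2 hj

/-- Every existential head variable of a plan occurs in each of its dissociated subgoals. -/
theorem mem_vars_or_mem_dissociationOf {x : V} (hx : x ∈ q.headVars P) (hxh : x ∉ q.head)
    {i : Fin m} (hi : i ∈ P.leaves) : x ∈ (q.atom i).vars ∨ x ∈ q.dissociationOf P i := by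
  induction P with
  | atom l =>
    obtain rfl : i = l := by simpa [leaves] using hi
    exact .inl hx
  | proj y P ih => exact ih (Finset.mem_sdiff.1 hx).1 hi
  | join P ih =>
    obtain ⟨j, hj⟩ := mem_leaves_join.1 hi
    rw [mem_dissociationOf_join]
    by_cases hxj : x ∈ q.headVars (P j)
    · exact (ih j hxj hj).imp_right fun h => ⟨j, hj, .inl h⟩
    · exact .inr ⟨j, hj, .inr ⟨⟨hx, hxj⟩, hxh⟩⟩

/-- The variables of a dissociated subgoal are head variables of the plan or projected away. -/
theorem mem_headVars_or_mem_projected {x : V} {i : Fin m} (hi : i ∈ P.leaves)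
    (hx : x ∈ (q.atom i).vars ∨ x ∈ q.dissociationOf P i) :
    x ∈ q.headVars P ∨ x ∈ P.projected := by
  induction P with
  | atom l =>
    obtain rfl : i = l := by simpa [leaves] using hi
    exact .inl (hx.resolve_right (Finset.notMem_empty x))
  | proj y P ih =>
    have := ih hi hx
    simp only [headVars, projected, Finset.mem_sdiff, Multiset.mem_add, Finset.mem_val]
    tauto
  | join P ih =>
    have hmono : ∀ {j}, x ∈ q.headVars (P j) ∨ x ∈ (P j).projected →
        x ∈ q.headVars (.join P) ∨ x ∈ (Plan.join P).projected := fun {j} h =>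
      h.imp (fun h => mem_headVars_join.2 ⟨j, h⟩) fun h => mem_projected_join.2 ⟨j, h⟩
    rw [mem_dissociationOf_join] at hx
    obtain hx | ⟨j, hj, hx | hx⟩ := hx
    · obtain ⟨j, hj⟩ := mem_leaves_join.1 hi
      exact hmono (ih j hj (.inl hx))
    · exact hmono (ih j hj (.inr hx))
    · exact .inl hx.1.1

theorem notMem_head_of_mem_dissociationOf {x : V} {i : Fin m} (hx : x ∈ q.dissociationOf P i) :
    x ∉ q.head := by
  induction P with
  | atom l => simp [dissociationOf] at hx
  | proj y P ih => exact ih hx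
  | join P ih =>
    obtain ⟨j, -, hx | hx⟩ := mem_dissociationOf_join.1 hx
    · exact ih j hx
    · exact hx.2

/-- Here `H` stands for the variables projected away above `P`; it is included at every leaf because
the joins above `P` have not yet made their contribution. A variable outside `H` listed at a leaf
must be projected away inside the operand containing that leaf, so if two operands shared one, it
would be projected away twice. -/
theorem WellFormed.adapted (hw : q.WellFormed P) (hl : P.leaves.Nodup)
    (hp : P.projected.Nodup) (hph : ∀ x ∈ P.projected, x ∉ q.head)
    (hpH : ∀ x ∈ P.projected, x ∉ H) (hH : ∀ x ∈ q.headVars P, x ∉ q.head → x ∈ H) :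
    P.Adapted (fun i => ((q.atom i).vars \ q.head) ∪ q.dissociationOf P i ∪ H) H := by
  induction P generalizing H with
  | atom i =>
    show _ ∪ _ ∪ _ = _
    simp only [dissociationOf, Finset.union_empty, Finset.union_eq_right]
    intro x hx
    rw [Finset.mem_sdiff] at hx
    exact hH x hx.1 hx.2
  | proj y P ih =>
    simp only [projected, Multiset.mem_add, Finset.mem_val] at hph hpH
    obtain ⟨-, hp, hpd⟩ := Multiset.nodup_add.1 hp
    refine ⟨hw.1, Finset.disjoint_left.2 fun x hx => hpH x (.inl hx), hw.2.2.1, ?_⟩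
    -- Moving `y` into `H` leaves the listed sets unchanged: an existential head variable of `P` is
    -- already present, originally or by dissociation, at each leaf of `P`.
    refine (ih hw.2.2.2 hl hp (fun x hx => hph x (.inr hx)) (H := H ∪ y) (fun x hx => ?_)
      fun x hx hxh => ?_).congr fun i hi => ?_
    · rw [Finset.mem_union, not_or]
      exact ⟨hpH x (.inr hx), fun hxy => Multiset.disjoint_left.1 hpd hxy hx⟩
    · by_cases hxy : x ∈ y
      · exact Finset.mem_union_right _ hxy
      · exact Finset.mem_union_left _ (hH x (Finset.mem_sdiff.2 ⟨hx, hxy⟩) hxh)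
    · ext x
      have : x ∈ y → x ∉ q.head ∧ (x ∈ (q.atom i).vars ∨ x ∈ q.dissociationOf P i) := fun hx =>
        ⟨hph x (.inl hx), mem_vars_or_mem_dissociationOf (hw.2.1 hx) (hph x (.inl hx)) hi⟩
      simp only [Finset.mem_union, Finset.mem_sdiff, dissociationOf]
      tauto
  | join P ih =>
    obtain ⟨hl, hld⟩ := nodup_sum_univ.1 hl
    obtain ⟨hp, hpd⟩ := nodup_sum_univ.1 hp
    have hPj : ∀ j, (P j).Adapted
        (fun i => ((q.atom i).vars \ q.head) ∪ q.dissociationOf (P j) i ∪ H) H := fun j =>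
      ih j (hw.2 j).2 (hl j) (hp j) (fun x hx => hph x (mem_projected_join.2 ⟨j, hx⟩))
        (fun x hx => hpH x (mem_projected_join.2 ⟨j, hx⟩))
        fun x hx => hH x (mem_headVars_join.2 ⟨j, hx⟩)
    have hA : ∀ j, ∀ i ∈ (P j).leaves,
        ((q.atom i).vars \ q.head) ∪ q.dissociationOf (P j) i ∪ H =
          ((q.atom i).vars \ q.head) ∪ q.dissociationOf (.join P) i ∪ H := by
      intro j i hi
      ext x
      simp only [Finset.mem_union, mem_dissociationOf_join]
      constructor
      · rintro ((hx | hx) | hx)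
        · exact .inl (.inl hx)
        · exact .inl (.inr ⟨j, hi, .inl hx⟩)
        · exact .inr hx
      · rintro ((hx | ⟨l, hl, hx | hx⟩) | hx)
        · exact .inl (.inl hx)
        · by_cases hjl : j = l
          · exact .inl (.inr (hjl ▸ hx))
          · exact (hld j l hjl i hi hl).elim
        · exact .inr (hH x hx.1.1 hx.2)
        · exact .inr hx
    have hmem : ∀ j, ∀ i ∈ (P j).leaves, ∀ x,
        x ∈ ((q.atom i).vars \ q.head) ∪ q.dissociationOf (.join P) i ∪ H → x ∉ H →
          x ∈ (P j).projected := by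
      intro j i hi x hx hxH
      rw [← hA j i hi, Finset.mem_union, or_iff_left hxH, Finset.mem_union,
        Finset.mem_sdiff] at hx
      refine (mem_headVars_or_mem_projected hi (hx.imp_left And.left)).resolve_left fun h => hxH ?_
      exact hH x (mem_headVars_join.2 ⟨j, h⟩)
        (hx.elim And.right notMem_head_of_mem_dissociationOf)
    refine ⟨hw.1, fun j => ⟨(hw.2 j).1, (hPj j).congr (hA j)⟩, fun j l hjl i hi i' hi' =>
      ⟨fun h => hld j l hjl i hi (h ▸ hi'), fun x hx => ?_⟩⟩
    by_contra hxH
    rw [Finset.mem_inter] at hx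
    exact hpd j l hjl x (hmem j i hi x hx.1 hxH) (hmem l i' hi' x hx.2 hxH)

/-- The existential variables of the subgoals after adding the variables of `Δ`. -/
def extendedVars (q : CQ σ V C m) (Δ : Fin m → Finset V) (i : Fin m) : Finset V :=
  ((q.atom i).vars ∪ Δ i) \ q.head

theorem IsPlan.adapted (h : q.IsPlan P) : P.Adapted (q.extendedVars (q.dissociationOf P)) ∅ := by
  refine (h.wellFormed.adapted (H := ∅) (by rw [h.leaves_eq]; exact Finset.univ.nodup)
    h.nodup_projected h.projected_notMem_head (by simp)
    (by rw [h.headVars_eq]; exact fun x hx hx' => (hx' hx).elim)).congr fun i _ => ?_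
  ext x
  have := fun hx => notMem_head_of_mem_dissociationOf (q := q) (P := P) (i := i) (x := x) hx
  simp only [extendedVars, Finset.mem_union, Finset.mem_sdiff, Finset.notMem_empty, or_false]
  tauto

theorem IsPlan.mem_leaves (h : q.IsPlan P) (i : Fin m) : i ∈ P.leaves := by
  rw [h.leaves_eq]; exact Finset.mem_univ i

theorem covers_extendedVars (q : CQ σ V C m) (Δ : Fin m → Finset V) :
    q.Covers (q.extendedVars Δ) where
  vars_subset _ _ hx hxh := Finset.mem_sdiff.2 ⟨Finset.mem_union_left _ hx, hxh⟩
  notMem_head _ _ hx := (Finset.mem_sdiff.1 hx).2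

theorem extendedVars_subset_vars {Δ : Fin m → Finset V} (hΔ : ∀ i, Δ i ⊆ q.vars) (i : Fin m) :
    q.extendedVars Δ i ⊆ q.vars :=
  Finset.sdiff_subset.trans (Finset.union_subset
    (Finset.subset_biUnion_of_mem (fun i => (q.atom i).vars) (Finset.mem_univ i)) (hΔ i))

theorem IsPlan.isDissociation (h : q.IsPlan P) : q.IsDissociation (q.dissociationOf P) := by
  have hv : ∀ i, q.dissociationOf P i ⊆ q.vars := fun i x hx =>
    (mem_headVars_or_mem_projected (h.mem_leaves i) (.inr hx)).elim
      (fun h => headVars_subset_vars P h) fun hx => h.wellFormed.projected_subset_vars hx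
  -- Feeding `P` back through its adapted description shows that the added variables are those of
  -- `extendedVars` not already in the subgoal, so nothing is added twice.
  obtain ⟨-, h2⟩ := isPlan_of_adapted (q.covers_extendedVars _) (extendedVars_subset_vars hv)
    h.adapted h.leaves_eq
  intro i x hx
  have hx' := hx
  rw [h2 i, Finset.mem_sdiff] at hx'
  exact Finset.mem_sdiff.2 ⟨Finset.mem_sdiff.2 ⟨hv i hx, notMem_head_of_mem_dissociationOf hx⟩, hx'.2⟩

/-- Plans for `q` with dissociation `Δ` are the plans that are adapted to the variables of `q^Δ`. -/
theorem isPlan_and_dissociationOf_iff {Δ : Fin m → Finset V} (hΔ : q.IsDissociation Δ) :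
    q.IsPlan P ∧ q.dissociationOf P = Δ ↔
      P.Adapted (q.extendedVars Δ) ∅ ∧ P.leaves = (Finset.univ : Finset (Fin m)).val := by
  constructor
  · rintro ⟨h, rfl⟩
    exact ⟨h.adapted, h.leaves_eq⟩
  · rintro ⟨h, hl⟩
    obtain ⟨h1, h2⟩ := isPlan_of_adapted (q.covers_extendedVars Δ)
      (extendedVars_subset_vars fun i x hx =>
        (Finset.mem_sdiff.1 (Finset.mem_sdiff.1 (hΔ i hx)).1).1) h hl
    refine ⟨h1, funext fun i => (h2 i).trans ?_⟩
    ext x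
    have := fun hx : x ∈ Δ i => hΔ i hx
    simp only [extendedVars, evars, Finset.mem_sdiff, Finset.mem_union] at this ⊢
    tauto

/-! ### Safe plans and hierarchical queries -/

theorem isDissociation_empty : q.IsDissociation fun _ => ∅ := fun _ => Finset.empty_subset _

/-- Operands of a join have equal existential head variables exactly when none of them misses a join
variable, that is, when the join adds nothing. Adaptedness guarantees that each operand has a leaf
where a missing variable would show up. -/
theorem safePlan_iff (h : P.Adapted A H) :
    q.SafePlan P ↔ ∀ i ∈ P.leaves, q.dissociationOf P i = ∅ := by
  induction P generalizing H with
  | atom i => simp [SafePlan, dissociationOf]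
  | proj y P ih => exact ih h.2.2.2
  | @join k P ih =>
    simp only [SafePlan, fun j => ih j (h.2.1 j).2]
    constructor
    · rintro ⟨h1, h2⟩ i -
      refine Finset.eq_empty_of_forall_notMem fun x hx => ?_
      obtain ⟨j, hj, hx | ⟨⟨hx, hxj⟩, hxh⟩⟩ := mem_dissociationOf_join.1 hx
      · simp [h2 j i hj] at hx
      · obtain ⟨l, hl⟩ := mem_headVars_join.1 hx
        have : x ∈ q.headVars (P l) \ q.head := Finset.mem_sdiff.2 ⟨hl, hxh⟩
        rw [h1 l j] at this
        exact hxj (Finset.mem_sdiff.1 this).1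
    · intro h0
      have h0' : ∀ j, ∀ i ∈ (P j).leaves, ∀ x, ¬ (x ∈ q.dissociationOf (P j) i ∨
          (x ∈ q.headVars (.join P) ∧ x ∉ q.headVars (P j)) ∧ x ∉ q.head) := fun j i hi x hx => by
        have : x ∈ q.dissociationOf (.join P) i := mem_dissociationOf_join.2 ⟨j, hi, hx⟩
        simp [h0 i (mem_leaves_join.2 ⟨j, hi⟩)] at this
      have hsub : ∀ j l, q.headVars (P j) \ q.head ⊆ q.headVars (P l) \ q.head := by
        intro j l x hx
        rw [Finset.mem_sdiff] at hx ⊢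
        refine ⟨?_, hx.2⟩
        by_contra hxl
        obtain ⟨i, hi⟩ := (h.2.1 l).2.exists_leaf
        exact h0' l i hi x (.inr ⟨⟨mem_headVars_join.2 ⟨j, hx.1⟩, hxl⟩, hx.2⟩)
      exact ⟨fun j l => (hsub j l).antisymm (hsub l j), fun j i hi =>
        Finset.eq_empty_of_forall_notMem fun x hx => h0' j i hi x (.inl hx)⟩

/-- The safe plans for `q` are the plans that are adapted to the variables of `q`. -/
theorem isPlan_and_safePlan_iff :
    q.IsPlan P ∧ q.SafePlan P ↔
      P.Adapted (fun i => (q.atom i).vars \ q.head) ∅ ∧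
        P.leaves = (Finset.univ : Finset (Fin m)).val := by
  have h := isPlan_and_dissociationOf_iff (P := P) (isDissociation_empty (q := q))
  have he : q.extendedVars (fun _ => ∅) = fun i => (q.atom i).vars \ q.head := by
    funext i
    simp [extendedVars]
  rw [he] at h
  rw [← h]
  refine and_congr_right fun hP => (safePlan_iff hP.adapted).trans ?_
  exact ⟨fun h => funext fun i => h i (hP.mem_leaves i), fun h i _ => congrFun h i⟩

theorem dissAtom_vars (q : CQ σ V C m) (Δ : Fin m → Finset V) (i : Fin m) :
    (q.dissAtom Δ i).vars = (q.atom i).vars ∪ Δ i := by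
  ext x
  constructor
  · intro hx
    obtain ⟨k, -, hk⟩ := Finset.mem_biUnion.1 hx
    obtain k | y := k
    · exact Finset.mem_union_left _ (Finset.mem_biUnion.2 ⟨k, Finset.mem_univ _, hk⟩)
    · obtain rfl : x = y.1 := Finset.mem_singleton.1 hk
      exact Finset.mem_union_right _ y.2
  · intro hx
    obtain hx | hx := Finset.mem_union.1 hx
    · exact q.vars_subset_dissAtom_vars Δ i hx
    · exact Finset.mem_biUnion.2 ⟨.inr ⟨x, hx⟩, Finset.mem_univ _, by simp [dissAtom, Term.vars]⟩

theorem dissociate_isPlan_and_safePlan_iff {Δ : Fin m → Finset V} :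
    (q.dissociate Δ).IsPlan P ∧ (q.dissociate Δ).SafePlan P ↔
      P.Adapted (q.extendedVars Δ) ∅ ∧ P.leaves = (Finset.univ : Finset (Fin m)).val := by
  have he : (fun i => ((q.dissociate Δ).atom i).vars \ (q.dissociate Δ).head) =
      q.extendedVars Δ := funext fun i => by
    simp only [dissociate, dissAtom_vars, extendedVars]
  rw [isPlan_and_safePlan_iff, he]

/-- A variable listed at no leaf satisfies one of the inclusions vacuously, so the condition may be
stated for all variables, as the construction of the plan requires. -/
theorem dissociate_hierarchical_iff {Δ : Fin m → Finset V} :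
    (q.dissociate Δ).Hierarchical ↔ ∀ x y,
      (∀ i, x ∈ q.extendedVars Δ i → y ∈ q.extendedVars Δ i) ∨
      (∀ i, x ∈ q.extendedVars Δ i → y ∉ q.extendedVars Δ i) ∨
      ∀ i, y ∈ q.extendedVars Δ i → x ∈ q.extendedVars Δ i := by
  have hsg : ∀ x i, i ∈ (q.dissociate Δ).sg x ↔ x ∈ (q.atom i).vars ∪ Δ i := fun x i => by
    simp only [sg, dissociate, dissAtom_vars, Finset.mem_filter, Finset.mem_univ, true_and]
  have hev : ∀ {x}, x ∈ (q.dissociate Δ).evars ↔ ∃ i, x ∈ q.extendedVars Δ i := fun {x} => by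
    simp only [evars, vars, dissociate, dissAtom_vars, Finset.mem_sdiff, Finset.mem_biUnion,
      Finset.mem_univ, true_and, extendedVars, exists_and_right]
  have hext : ∀ {x i}, x ∉ q.head → (x ∈ q.extendedVars Δ i ↔ x ∈ (q.atom i).vars ∪ Δ i) :=
    fun hx => Finset.mem_sdiff.trans (and_iff_left hx)
  have hiff : ∀ x ∈ (q.dissociate Δ).evars, ∀ y ∈ (q.dissociate Δ).evars,
      (((q.dissociate Δ).sg x ⊆ (q.dissociate Δ).sg y ∨
        Disjoint ((q.dissociate Δ).sg x) ((q.dissociate Δ).sg y) ∨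
        (q.dissociate Δ).sg y ⊆ (q.dissociate Δ).sg x) ↔
      ((∀ i, x ∈ q.extendedVars Δ i → y ∈ q.extendedVars Δ i) ∨
      (∀ i, x ∈ q.extendedVars Δ i → y ∉ q.extendedVars Δ i) ∨
      ∀ i, y ∈ q.extendedVars Δ i → x ∈ q.extendedVars Δ i)) := by
    intro x hx y hy
    have hxh : x ∉ q.head := (Finset.mem_sdiff.1 hx).2
    have hyh : y ∉ q.head := (Finset.mem_sdiff.1 hy).2
    simp only [Finset.subset_iff, Finset.disjoint_left, hsg, hext hxh, hext hyh]
  constructor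
  · intro h x y
    by_cases hx : x ∈ (q.dissociate Δ).evars
    · by_cases hy : y ∈ (q.dissociate Δ).evars
      · exact (hiff x hx y hy).1 (h x hx y hy)
      · exact .inr (.inr fun i hi => (hy (hev.2 ⟨i, hi⟩)).elim)
    · exact .inl fun i hi => (hx (hev.2 ⟨i, hi⟩)).elim
  · exact fun h x hx y hy => (hiff x hx y hy).2 (h x y)

/-! ### The bijection -/

theorem IsPlan.isSafeDissociation (h : q.IsPlan P) :
    q.IsSafeDissociation (q.dissociationOf P) := by
  refine ⟨h.isDissociation, dissociate_hierarchical_iff.2 fun x y => ?_⟩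
  simpa [h.mem_leaves] using
    h.adapted.laminar (Finset.notMem_empty x) (Finset.notMem_empty y)

theorem IsSafeDissociation.exists_plan (hm : 1 ≤ m) {Δ : Fin m → Finset V}
    (h : q.IsSafeDissociation Δ) : ∃ P, q.IsPlan P ∧ q.dissociationOf P = Δ := by
  obtain ⟨P, hP⟩ := exists_adapted (q.extendedVars Δ) (dissociate_hierarchical_iff.1 h.2)
    Finset.univ ⟨⟨0, hm⟩, Finset.mem_univ _⟩ ∅ fun _ _ => Finset.empty_subset _
  exact ⟨P, (isPlan_and_dissociationOf_iff h.1).2 hP⟩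

/-- Plans for `q` are equal up to the order of the operands of joins iff they have the same
dissociation. -/
theorem IsPlan.equiv_iff {P' : Plan m V} (h : q.IsPlan P) (h' : q.IsPlan P') :
    P.Equiv P' ↔ q.dissociationOf P = q.dissociationOf P' := by
  constructor
  · intro he
    exact ((isPlan_and_dissociationOf_iff h.isDissociation).2
      ⟨he.adapted h.adapted, h'.leaves_eq⟩).2.symm
  · intro he
    have h2 := h'.adapted
    rw [← he] at h2
    exact h.adapted.equiv h2 fun i => by simp [h.mem_leaves, h'.mem_leaves]

/-- The bijection between query plans and safe dissociations. -/
def queryPlanEquiv (q : CQ σ V C m) (hm : 1 ≤ m) : q.QueryPlan ≃ q.SafeDiss :=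
  Equiv.ofBijective
    (Quotient.lift (fun P : {P : Plan m V // q.IsPlan P} =>
      (⟨q.dissociationOf P.1, P.2.isSafeDissociation⟩ : q.SafeDiss))
      fun P P' h => Subtype.ext ((P.2.equiv_iff P'.2).1 h)) (by
    constructor
    · intro a b
      refine Quotient.inductionOn₂ a b fun P P' h => Quotient.sound ?_
      exact (P.2.equiv_iff P'.2).2 (congrArg Subtype.val h)
    · rintro ⟨Δ, hΔ⟩
      obtain ⟨P, hP, hPΔ⟩ := hΔ.exists_plan hm
      exact ⟨QueryPlan.mk P hP, Subtype.ext hPΔ⟩)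

theorem queryPlanEquiv_mk (hm : 1 ≤ m) (h : q.IsPlan P) :
    (q.queryPlanEquiv hm (QueryPlan.mk P h)).1 = q.dissociationOf P :=
  rfl

/-- The safe plans of the dissociated query are the plans equivalent to `P`. -/
theorem IsPlan.dissociate_iff (h : q.IsPlan P) {P' : Plan m V} :
    ((q.dissociate (q.dissociationOf P)).IsPlan P' ∧
      (q.dissociate (q.dissociationOf P)).SafePlan P') ↔ P'.Equiv P := by
  rw [dissociate_isPlan_and_safePlan_iff]
  constructor
  · rintro ⟨h1, h2⟩
    exact h1.equiv h.adapted fun i => by simp [h2, h.leaves_eq]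
  · intro he
    exact ⟨he.symm.adapted h.adapted, he.leaves_eq.trans h.leaves_eq⟩

end CQ

/-! ### Probabilities of events in a tuple-independent database -/

/-- The probability that exactly the elements of `U` are selected from `G`. -/
def selectProb {α : Type*} [DecidableEq α] (p : α → ℝ) (G U : Finset α) : ℝ :=
  (∏ t ∈ U, p t) * ∏ t ∈ G \ U, (1 - p t)

/-- Multiply out `∏ t ∈ G, (p t + (1 - p t)) = 1`. -/
theorem sum_selectProb {α : Type*} [DecidableEq α] (p : α → ℝ) (G : Finset α) :
    ∑ U ∈ G.powerset, selectProb p G U = 1 := by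
  have h := Finset.prod_add p (fun t => 1 - p t) G
  simp only [add_sub_cancel, Finset.prod_const_one] at h
  exact h.symm

theorem selectProb_union {α : Type*} [DecidableEq α] (p : α → ℝ) {F G U T : Finset α} (hFG : Disjoint F G)
    (hU : U ⊆ F) (hT : T ⊆ G) :
    selectProb p (F ∪ G) (U ∪ T) = selectProb p F U * selectProb p G T := by
  have hsd : (F ∪ G) \ (U ∪ T) = (F \ U) ∪ (G \ T) := by
    ext t
    have h1 := fun h : t ∈ F => Finset.disjoint_left.1 hFG h
    have h2 := fun h : t ∈ U => hU h
    have h3 := fun h : t ∈ T => hT h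
    simp only [Finset.mem_sdiff, Finset.mem_union]
    tauto
  rw [selectProb, selectProb, selectProb, hsd, Finset.prod_union (hFG.mono hU hT),
    Finset.prod_union (hFG.mono Finset.sdiff_subset Finset.sdiff_subset)]
  ring

theorem sum_powerset_union {α : Type*} [DecidableEq α] {F G : Finset α} (hFG : Disjoint F G)
    (g : Finset α → ℝ) :
    ∑ W ∈ (F ∪ G).powerset, g W = ∑ U ∈ F.powerset, ∑ T ∈ G.powerset, g (U ∪ T) := by
  rw [← Finset.sum_product']
  symm
  refine Finset.sum_bij' (fun p _ => p.1 ∪ p.2) (fun W _ => (W ∩ F, W ∩ G)) ?_ ?_ ?_ ?_ ?_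
  · rintro ⟨U, T⟩ h
    simp only [Finset.mem_product, Finset.mem_powerset] at h ⊢
    exact Finset.union_subset_union h.1 h.2
  · intro W _
    simp [Finset.inter_subset_right]
  · rintro ⟨U, T⟩ h
    simp only [Finset.mem_product, Finset.mem_powerset] at h
    refine Prod.ext ?_ ?_
    · ext t
      have h1 := fun ht : t ∈ F => Finset.disjoint_left.1 hFG ht
      have h2 := fun ht : t ∈ U => h.1 ht
      have h3 := fun ht : t ∈ T => h.2 ht
      simp only [Finset.mem_inter, Finset.mem_union]
      tauto
    · ext t
      have h1 := fun ht : t ∈ F => Finset.disjoint_left.1 hFG ht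
      have h2 := fun ht : t ∈ U => h.1 ht
      have h3 := fun ht : t ∈ T => h.2 ht
      simp only [Finset.mem_inter, Finset.mem_union]
      tauto
  · intro W hW
    rw [Finset.mem_powerset] at hW
    rw [← Finset.inter_union_distrib_left, Finset.inter_eq_left.2 hW]
  · intro _ _
    rfl

namespace PDB

variable {D : PDB σ C} {E E₁ E₂ : Finset (Fact σ C) → Prop} {S S₁ S₂ : Set (Fact σ C)}

/-- The probability that the event `E` holds in a random possible world. -/
def probOf (D : PDB σ C) (E : Finset (Fact σ C) → Prop) : ℝ :=
  ∑ W ∈ D.facts.powerset, if E W then D.worldProb W else 0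

/-- The truth of `E` in a possible world is determined by the facts in `S`. -/
def DependsOn (D : PDB σ C) (E : Finset (Fact σ C) → Prop) (S : Set (Fact σ C)) : Prop :=
  ∀ W ⊆ D.facts, ∀ W' ⊆ D.facts, (∀ f ∈ S, f ∈ W ↔ f ∈ W') → (E W ↔ E W')

theorem probOf_congr (h : ∀ W ⊆ D.facts, E₁ W ↔ E₂ W) : D.probOf E₁ = D.probOf E₂ :=
  Finset.sum_congr rfl fun W hW => by simp only [h W (Finset.mem_powerset.1 hW)]

theorem probOf_true : D.probOf (fun _ => True) = 1 := by
  simp only [probOf, if_true]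
  exact sum_selectProb (fun t : Fact σ C => D.prob t.1 t.2) D.facts

theorem probOf_not : D.probOf (fun W => ¬ E W) = 1 - D.probOf E := by
  rw [eq_sub_iff_add_eq, ← probOf_true (D := D), probOf, probOf, probOf, ← Finset.sum_add_distrib]
  refine Finset.sum_congr rfl fun W _ => ?_
  by_cases h : E W <;> simp [h]

theorem DependsOn.not (h : D.DependsOn E S) : D.DependsOn (fun W => ¬ E W) S :=
  fun W hW W' hW' hS => not_congr (h W hW W' hW' hS)

/-- The sum over all worlds, split into the facts in `S` and the others. -/
theorem probOf_eq_sum_sum (D : PDB σ C) (E : Finset (Fact σ C) → Prop) (S : Set (Fact σ C)) :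
    D.probOf E = ∑ U ∈ (D.facts.filter (· ∈ S)).powerset,
      ∑ T ∈ (D.facts.filter (· ∉ S)).powerset,
        if E (U ∪ T) then selectProb (fun t => D.prob t.1 t.2) (D.facts.filter (· ∈ S)) U *
          selectProb (fun t => D.prob t.1 t.2) (D.facts.filter (· ∉ S)) T else 0 := by
  have hd : Disjoint (D.facts.filter (· ∈ S)) (D.facts.filter (· ∉ S)) :=
    Finset.disjoint_left.2 fun f hf hf' => (Finset.mem_filter.1 hf').2 (Finset.mem_filter.1 hf).2
  have hu : D.facts.filter (· ∈ S) ∪ D.facts.filter (· ∉ S) = D.facts := by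
    ext f
    simp only [Finset.mem_union, Finset.mem_filter]
    tauto
  have h := sum_powerset_union hd fun W => if E W then D.worldProb W else 0
  rw [hu] at h
  refine h.trans (Finset.sum_congr rfl fun U hU => Finset.sum_congr rfl fun T hT => ?_)
  rw [← selectProb_union _ hd (Finset.mem_powerset.1 hU) (Finset.mem_powerset.1 hT), hu]
  rfl

/-- Marginalization: the choices among facts outside `S` do not affect `E`, and their probabilities
sum to 1. -/
theorem DependsOn.probOf_eq (h : D.DependsOn E S) :
    D.probOf E = ∑ U ∈ (D.facts.filter (· ∈ S)).powerset,
      if E U then selectProb (fun t => D.prob t.1 t.2) (D.facts.filter (· ∈ S)) U else 0 := by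
  rw [probOf_eq_sum_sum D E S]
  refine Finset.sum_congr rfl fun U hU => ?_
  rw [Finset.mem_powerset] at hU
  have hE : ∀ T ∈ (D.facts.filter (· ∉ S)).powerset, (E (U ∪ T) ↔ E U) := fun T hT => by
    rw [Finset.mem_powerset] at hT
    have hU' := hU.trans (Finset.filter_subset _ _)
    refine h _ (Finset.union_subset hU' (hT.trans (Finset.filter_subset _ _))) _ hU'
      fun f hf => ?_
    have : f ∉ T := fun hfT => (Finset.mem_filter.1 (hT hfT)).2 hf
    simp [this]
  rw [Finset.sum_congr rfl fun T hT => by rw [if_congr (hE T hT) rfl rfl]]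
  split_ifs
  · rw [← Finset.mul_sum, sum_selectProb, mul_one]
  · simp

/-- Events that depend on disjoint sets of facts are independent. -/
theorem probOf_and (h₁ : D.DependsOn E₁ S₁) (h₂ : D.DependsOn E₂ S₂) (hS : Disjoint S₁ S₂) :
    D.probOf (fun W => E₁ W ∧ E₂ W) = D.probOf E₁ * D.probOf E₂ := by
  -- Enlarging `S₂` to the complement of `S₁` lets one splitting of the worlds serve both events,
  -- and the double sum factors.
  have h₂' : D.DependsOn E₂ S₁ᶜ := fun W hW W' hW' h => h₂ W hW W' hW' fun f hf =>
    h f fun hf' => Set.disjoint_left.1 hS hf' hf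
  rw [probOf_eq_sum_sum D _ S₁, h₁.probOf_eq, h₂'.probOf_eq, Finset.sum_mul_sum]
  simp only [Set.mem_compl_iff]
  refine Finset.sum_congr rfl fun U hU => Finset.sum_congr rfl fun T hT => ?_
  rw [Finset.mem_powerset] at hU hT
  have hU' := hU.trans (Finset.filter_subset _ _)
  have hT' := hT.trans (Finset.filter_subset _ _)
  have hUT := Finset.union_subset hU' hT'
  have e₁ : E₁ (U ∪ T) ↔ E₁ U := h₁ _ hUT _ hU' fun f hf => by
    have : f ∉ T := fun hfT => (Finset.mem_filter.1 (hT hfT)).2 hf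
    simp [this]
  have e₂ : E₂ (U ∪ T) ↔ E₂ T := h₂' _ hUT _ hT' fun f hf => by
    have : f ∉ U := fun hfU => hf (Finset.mem_filter.1 (hU hfU)).2
    simp [this]
  by_cases hE₁ : E₁ U <;> by_cases hE₂ : E₂ T <;> simp [e₁, e₂, hE₁, hE₂]

theorem probOf_forall {ι : Type*} (s : Finset ι) {E : ι → Finset (Fact σ C) → Prop}
    {S : ι → Set (Fact σ C)} (hE : ∀ i ∈ s, D.DependsOn (E i) (S i))
    (hS : ∀ i ∈ s, ∀ j ∈ s, i ≠ j → Disjoint (S i) (S j)) :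
    D.probOf (fun W => ∀ i ∈ s, E i W) = ∏ i ∈ s, D.probOf (E i) := by
  induction s using Finset.induction_on with
  | empty => simpa using probOf_true
  | insert a s ha ih =>
    rw [Finset.prod_insert ha, ← ih (fun i hi => hE i (Finset.mem_insert_of_mem hi))
      fun i hi j hj => hS i (Finset.mem_insert_of_mem hi) j (Finset.mem_insert_of_mem hj)]
    have hd : D.DependsOn (fun W => ∀ i ∈ s, E i W) (⋃ i ∈ s, S i) := fun W hW W' hW' h =>
      forall₂_congr fun i hi => hE i (Finset.mem_insert_of_mem hi) W hW W' hW' fun f hf =>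
        h f (Set.mem_biUnion hi hf)
    rw [← probOf_and (hE a (Finset.mem_insert_self a s)) hd]
    · exact probOf_congr fun W _ => Finset.forall_mem_insert ..
    · exact Set.disjoint_iUnion₂_right.2 fun i hi => hS a (Finset.mem_insert_self a s) i
        (Finset.mem_insert_of_mem hi) fun h => ha (h ▸ hi)

theorem probOf_exists {ι : Type*} (s : Finset ι) {E : ι → Finset (Fact σ C) → Prop}
    {S : ι → Set (Fact σ C)} (hE : ∀ i ∈ s, D.DependsOn (E i) (S i))
    (hS : ∀ i ∈ s, ∀ j ∈ s, i ≠ j → Disjoint (S i) (S j)) :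
    D.probOf (fun W => ∃ i ∈ s, E i W) = 1 - ∏ i ∈ s, (1 - D.probOf (E i)) := by
  have h : D.probOf (fun W => ∃ i ∈ s, E i W) = D.probOf fun W => ¬ ∀ i ∈ s, ¬ E i W :=
    probOf_congr fun W _ => by simp
  rw [h, probOf_not, probOf_forall s (fun i hi => (hE i hi).not) hS]
  simp only [probOf_not]

theorem probOf_mem (D : PDB σ C) (f : Fact σ C) :
    D.probOf (fun W => f ∈ W) = if f ∈ D.facts then D.prob f.1 f.2 else 0 := by
  split_ifs with hf
  · have h : D.DependsOn (fun W => f ∈ W) {f} := fun W _ W' _ h => h f rfl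
    have hs : ∀ S : Set (Fact σ C), S = {f} → D.facts.filter (· ∈ S) = {f} := by
      rintro S rfl
      ext g
      simp only [Finset.mem_filter, Set.mem_singleton_iff, Finset.mem_singleton]
      exact ⟨And.right, fun h => ⟨h ▸ hf, h⟩⟩
    have hp : ({f} : Finset (Fact σ C)).powerset = {∅, {f}} := by
      ext U
      simp [Finset.subset_singleton_iff]
    have he := h.probOf_eq
    simp only [hs _ rfl] at he
    rw [he, hp, Finset.sum_pair (Finset.singleton_ne_empty f).symm]
    simp [selectProb]
  · refine Finset.sum_eq_zero fun W hW => if_neg fun h => hf (Finset.mem_powerset.1 hW h)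

end PDB

/-! ### Safe plans compute the reliability -/

theorem Atom.ground_eq_ground_iff {g : Atom σ V C} {ν ν' : V → C} :
    g.ground ν = g.ground ν' ↔ ∀ x ∈ g.vars, ν x = ν' x := by
  constructor
  · intro h x hx
    obtain ⟨k, -, hk⟩ := Finset.mem_biUnion.1 hx
    have h' := congrFun (eq_of_heq (Sigma.mk.inj h).2) k
    cases hg : g.args k with
    | var y =>
      rw [hg] at hk
      obtain rfl := Finset.mem_singleton.1 hk
      simpa only [hg, Term.eval] using h'
    | const c =>
      rw [hg] at hk
      exact (Finset.notMem_empty x hk).elim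
  · intro h
    refine Sigma.ext rfl (heq_of_eq (funext fun k => ?_))
    have hk : (g.args k).vars ⊆ g.vars :=
      Finset.subset_biUnion_of_mem (fun k => (g.args k).vars) (Finset.mem_univ k)
    show (g.args k).eval ν = (g.args k).eval ν'
    cases hg : g.args k with
    | var y => exact h y (hk (by rw [hg]; exact Finset.mem_singleton_self y))
    | const c => rfl

theorem Atom.mem_adom_of_ground_mem {D : PDB σ C} {g : Atom σ V C} {ν : V → C}
    (h : g.ground ν ∈ D.facts) {x : V} (hx : x ∈ g.vars) : ν x ∈ D.adom := by
  obtain ⟨k, -, hk⟩ := Finset.mem_biUnion.1 hx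
  have ht := (Finset.mem_sigma.1 h).2
  refine Finset.mem_biUnion.2 ⟨g.rel, Finset.mem_univ _, Finset.mem_biUnion.2
    ⟨_, ht, Finset.mem_image.2 ⟨k, Finset.mem_univ _, ?_⟩⟩⟩
  show (g.args k).eval ν = ν x
  cases hg : g.args k with
  | var y =>
    rw [hg] at hk
    rw [Finset.mem_singleton.1 hk]
    rfl
  | const c =>
    rw [hg] at hk
    exact (Finset.notMem_empty x hk).elim

theorem override_of_mem {ν : V → C} {y : Finset V} {μ : {x : V // x ∈ y} → C} {x : V}
    (hx : x ∈ y) : override ν y μ x = μ ⟨x, hx⟩ :=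
  dif_pos hx

theorem override_of_notMem {ν : V → C} {y : Finset V} {μ : {x : V // x ∈ y} → C} {x : V}
    (hx : x ∉ y) : override ν y μ x = ν x :=
  dif_neg hx

namespace CQ

open Plan

variable {q : CQ σ V C m} {D : PDB σ C} {P : Plan m V} {H K : Finset V} {L : Multiset (Fin m)}
  {ν : V → C}

/-- The subgoals in `L` are satisfied by a valuation that agrees with `ν` on `K`. -/
def HoldsOn (q : CQ σ V C m) (L : Multiset (Fin m)) (K : Finset V) (ν : V → C)
    (W : Finset (Fact σ C)) : Prop :=
  ∃ ν' : V → C, (∀ x ∈ K, ν' x = ν x) ∧ ∀ i ∈ L, (q.atom i).ground ν' ∈ W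

/-- The facts on which `HoldsOn` depends. -/
def support (q : CQ σ V C m) (L : Multiset (Fin m)) (K : Finset V) (ν : V → C) :
    Set (Fact σ C) :=
  {f | ∃ i ∈ L, ∃ ν' : V → C, (∀ x ∈ K, ν' x = ν x) ∧ (q.atom i).ground ν' = f}

theorem dependsOn_holdsOn (D : PDB σ C) :
    D.DependsOn (q.HoldsOn L K ν) (q.support L K ν) := fun _ _ _ _ h =>
  exists_congr fun ν' => and_congr_right fun hν' => forall₂_congr fun i hi =>
    h _ ⟨i, hi, ν', hν', rfl⟩

theorem SelfJoinFree.disjoint_support (hq : q.SelfJoinFree) {L' : Multiset (Fin m)}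
    {K' : Finset V} {ν' : V → C} (h : ∀ i ∈ L, i ∉ L') :
    Disjoint (q.support L K ν) (q.support L' K' ν') := by
  refine Set.disjoint_left.2 ?_
  rintro _ ⟨i, hi, ν₁, -, rfl⟩ ⟨i', hi', ν₂, -, he⟩
  exact h i hi ((hq (Sigma.mk.inj he).1 : i' = i) ▸ hi')

/-- The relation symbol of a fact identifies its subgoal, and since `y` occurs in every subgoal of
`L`, the fact also determines the values on `y`. -/
theorem SelfJoinFree.disjoint_support_override (hq : q.SelfJoinFree) {y : Finset V}
    (hy : ∀ i ∈ L, y ⊆ (q.atom i).vars) (hyK : y ⊆ K) {μ μ' : {x : V // x ∈ y} → C}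
    (hμ : μ ≠ μ') :
    Disjoint (q.support L K (override ν y μ)) (q.support L K (override ν y μ')) := by
  refine Set.disjoint_left.2 ?_
  rintro _ ⟨i, hi, ν₁, h₁, rfl⟩ ⟨i', hi', ν₂, h₂, he⟩
  obtain rfl : i' = i := hq (Sigma.mk.inj he).1
  refine hμ (funext fun x => ?_)
  have h := Atom.ground_eq_ground_iff.1 he x.1 (hy i' hi x.2)
  rw [h₁ _ (hyK x.2), h₂ _ (hyK x.2), override_of_mem x.2, override_of_mem x.2] at h
  exact h.symm

theorem holdsOn_atom {i : Fin m} (h : (q.atom i).vars ⊆ K) {W : Finset (Fact σ C)} :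
    q.HoldsOn (Plan.atom i : Plan m V).leaves K ν W ↔ (q.atom i).ground ν ∈ W := by
  simp only [HoldsOn, leaves, Multiset.mem_singleton, forall_eq]
  constructor
  · rintro ⟨ν', h1, h2⟩
    rwa [Atom.ground_eq_ground_iff.2 fun x hx => h1 x (h hx)] at h2
  · exact fun h => ⟨ν, fun _ _ => rfl, h⟩

/-- Restricting `y` to the active domain loses nothing: some subgoal contains all of `y`, and its
grounding is a fact of the database. -/
theorem holdsOn_override {y : Finset V} (hyK : Disjoint y K) {W : Finset (Fact σ C)}
    (hW : W ⊆ D.facts) (hy : ∃ i ∈ L, y ⊆ (q.atom i).vars) :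
    q.HoldsOn L K ν W ↔ ∃ μ ∈ Fintype.piFinset fun _ : {x : V // x ∈ y} => D.adom,
      q.HoldsOn L (K ∪ y) (override ν y μ) W := by
  have hyK := fun {x} (hx : x ∈ K) => Finset.disjoint_right.1 hyK hx
  constructor
  · rintro ⟨ν', h1, h2⟩
    obtain ⟨i, hi, hyi⟩ := hy
    refine ⟨fun x => ν' x.1, Fintype.mem_piFinset.2 fun x =>
      Atom.mem_adom_of_ground_mem (hW (h2 i hi)) (hyi x.2), ν', fun x hx => ?_, h2⟩
    by_cases hxy : x ∈ y
    · rw [override_of_mem hxy]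
    · rw [override_of_notMem hxy]
      exact h1 x ((Finset.mem_union.1 hx).resolve_right hxy)
  · rintro ⟨μ, -, ν', h1, h2⟩
    refine ⟨ν', fun x hx => ?_, h2⟩
    rw [h1 x (Finset.mem_union_left _ hx), override_of_notMem (hyK hx)]

theorem holdsOn_join {k : ℕ} {P : Fin k → Plan m V} {W : Finset (Fact σ C)}
    (h : ∀ j l, j ≠ l → ∀ i ∈ (P j).leaves, ∀ i' ∈ (P l).leaves,
      ∀ x ∈ (q.atom i).vars, x ∈ (q.atom i').vars → x ∈ K) :
    q.HoldsOn (Plan.join P).leaves K ν W ↔ ∀ j, q.HoldsOn (P j).leaves K ν W := by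
  constructor
  · rintro ⟨ν', h1, h2⟩ j
    exact ⟨ν', h1, fun i hi => h2 i (mem_leaves_join.2 ⟨j, hi⟩)⟩
  · intro hP
    choose ν' h1 h2 using hP
    -- Glue the valuations of the operands: a variable outside `K` occurs in at most one operand and
    -- takes its value from there.
    refine ⟨fun x => if hx : ∃ j, x ∉ K ∧ ∃ i ∈ (P j).leaves, x ∈ (q.atom i).vars then
      ν' hx.choose x else ν x, fun x hx => dif_neg fun ⟨j, hj, _⟩ => hj hx, fun i hi => ?_⟩
    obtain ⟨j, hj⟩ := mem_leaves_join.1 hi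
    have := h2 j i hj
    rwa [Atom.ground_eq_ground_iff.2 fun x hx => ?_] at this
    by_cases hxK : x ∈ K
    · rw [dif_neg fun ⟨j, hj, _⟩ => hj hxK, h1 j x hxK]
    · have hex : ∃ j, x ∉ K ∧ ∃ i ∈ (P j).leaves, x ∈ (q.atom i).vars :=
        ⟨j, hxK, i, hj, hx⟩
      rw [dif_pos hex]
      by_cases hjl : j = hex.choose
      · rw [← hjl]
      · obtain ⟨-, i', hi', hx'⟩ := hex.choose_spec
        exact (hxK (h j _ hjl i hj i' hi' x hx hx')).elim

/-- The score of an adapted plan is a probability: extensional evaluation is exact. -/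
theorem SelfJoinFree.probOf_holdsOn (hq : q.SelfJoinFree) (D : PDB σ C)
    (h : P.Adapted (fun i => (q.atom i).vars \ q.head) H) (ν : V → C) :
    D.probOf (q.HoldsOn P.leaves (H ∪ q.head) ν) = q.score D P ν := by
  induction P generalizing H ν with
  | atom i =>
    have hi : (q.atom i).vars \ q.head = H := h
    rw [PDB.probOf_congr fun W _ => holdsOn_atom (sdiff_le_iff.1 hi.le |>.trans
      (Finset.union_comm ..).subset)]
    exact D.probOf_mem _
  | proj y P ih =>
    have hy : ∀ i ∈ P.leaves, y ⊆ (q.atom i).vars \ q.head := fun i hi =>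
      Finset.subset_union_right.trans (h.2.2.2.subset hi)
    have hy' : ∀ i ∈ P.leaves, y ⊆ (q.atom i).vars := fun i hi =>
      (hy i hi).trans Finset.sdiff_subset
    obtain ⟨i, hi⟩ := h.2.2.2.exists_leaf
    have hyK : Disjoint y (H ∪ q.head) := Finset.disjoint_union_right.2
      ⟨h.2.1, Finset.disjoint_left.2 fun x hx => (Finset.mem_sdiff.1 (hy i hi hx)).2⟩
    rw [PDB.probOf_congr fun W hW => holdsOn_override (L := (Plan.proj y P).leaves)
      hyK hW ⟨i, hi, hy' i hi⟩]
    -- Different values of `y` involve disjoint sets of facts, so the existential quantifier becomes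
    -- the independent union of the projection operator.
    refine (PDB.probOf_exists _ (fun μ _ => dependsOn_holdsOn D) fun μ _ μ' _ hμ =>
      hq.disjoint_support_override hy' Finset.subset_union_right hμ).trans ?_
    simp only [score]
    congr 1
    refine Finset.prod_congr rfl fun μ _ => ?_
    rw [← ih h.2.2.2, Finset.union_right_comm]
  | join P ih =>
    have hE : ∀ W, q.HoldsOn (Plan.join P).leaves (H ∪ q.head) ν W ↔
        ∀ j ∈ Finset.univ, q.HoldsOn (P j).leaves (H ∪ q.head) ν W := fun W => by
      simp only [Finset.mem_univ, true_imp_iff]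
      refine holdsOn_join fun j l hjl i hi i' hi' x hx hx' => ?_
      by_cases hxh : x ∈ q.head
      · exact Finset.mem_union_right _ hxh
      · exact Finset.mem_union_left _ ((h.2.2 j l hjl i hi i' hi').2 (Finset.mem_inter.2
          ⟨Finset.mem_sdiff.2 ⟨hx, hxh⟩, Finset.mem_sdiff.2 ⟨hx', hxh⟩⟩))
    rw [PDB.probOf_congr fun W _ => hE W, PDB.probOf_forall _ (fun j _ => dependsOn_holdsOn D)
      fun j _ l _ hjl => hq.disjoint_support fun i hi hi' => (h.2.2 j l hjl i hi i hi').1 rfl]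
    exact Finset.prod_congr rfl fun j _ => ih j (h.2.1 j).2 ν

/-- A safe plan computes the reliability of a query without self-joins. -/
theorem SelfJoinFree.reliability_eq_score (hq : q.SelfJoinFree) (D : PDB σ C) (hP : q.IsPlan P)
    (hs : q.SafePlan P) (a : V → C) : q.reliability D a = q.score D P a := by
  rw [← hq.probOf_holdsOn D (isPlan_and_safePlan_iff.1 ⟨hP, hs⟩).1 a]
  refine PDB.probOf_congr fun W _ => exists_congr fun ν => ?_
  simp [hP.mem_leaves]

/-! ### Scores on the dissociated database -/

theorem dissociate_selfJoinFree (q : CQ σ V C m) (Δ : Fin m → Finset V) :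
    (q.dissociate Δ).SelfJoinFree := fun _ _ h => h

/-- A tuple with a nonzero score satisfies some ground subgoal for each of its variables. -/
theorem exists_ground_mem_of_score_ne_zero (h : q.score D P ν ≠ 0) {x : V}
    (hx : x ∈ q.headVars P) :
    ∃ i, ∃ ν' : V → C, x ∈ (q.atom i).vars ∧ ν' x = ν x ∧ (q.atom i).ground ν' ∈ D.facts := by
  induction P generalizing ν with
  | atom i =>
    refine ⟨i, ν, hx, rfl, ?_⟩
    by_contra hn
    exact h (by simp [score, hn])
  | proj y P ih =>
    obtain ⟨hx, hxy⟩ := Finset.mem_sdiff.1 hx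
    have : ∃ μ : {x : V // x ∈ y} → C, q.score D P (override ν y μ) ≠ 0 := by
      by_contra! hn
      exact h (by simp [score, hn])
    obtain ⟨μ, hμ⟩ := this
    obtain ⟨i, ν', h1, h2, h3⟩ := ih hμ hx
    exact ⟨i, ν', h1, h2.trans (override_of_notMem hxy), h3⟩
  | join P ih =>
    obtain ⟨j, hj⟩ := mem_headVars_join.1 hx
    exact ih j (Finset.prod_ne_zero_iff.1 h j (Finset.mem_univ j)) hj

theorem ground_dissAtom_mem_facts {Δ : Fin m → Finset V} {i : Fin m} :
    ((q.dissociate Δ).atom i).ground ν ∈ (q.dissociateDB Δ D).facts ↔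
      (q.atom i).ground ν ∈ D.facts ∧ ∀ x ∈ Δ i, ν x ∈ D.adom := by
  simp only [PDB.facts, Finset.mem_sigma, Finset.mem_univ, true_and]
  constructor
  · intro h
    obtain ⟨⟨t, s⟩, hp, he⟩ := Finset.mem_image.1 h
    obtain ⟨ht, hs⟩ := Finset.mem_product.1 hp
    refine ⟨?_, fun x hx => ?_⟩
    · have : t = ((q.atom i).ground ν).2 := funext fun k => congrFun he (.inl k)
      exact this ▸ ht
    · have : s ⟨x, hx⟩ = ν x := congrFun he (.inr ⟨x, hx⟩)
      exact this ▸ Fintype.mem_piFinset.1 hs ⟨x, hx⟩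
  · rintro ⟨h1, h2⟩
    refine Finset.mem_image.2 ⟨(((q.atom i).ground ν).2, fun x => ν x.1), Finset.mem_product.2
      ⟨h1, Fintype.mem_piFinset.2 fun x => h2 x.1 x.2⟩, funext fun k => ?_⟩
    cases k <;> rfl

/-- The inclusion can be strict: constants that occur only in tables not used by `q` may disappear.
-/
theorem dissociateDB_adom_subset (q : CQ σ V C m) (Δ : Fin m → Finset V) (D : PDB σ C) :
    (q.dissociateDB Δ D).adom ⊆ D.adom := by
  intro c hc
  obtain ⟨i, -, hc⟩ := Finset.mem_biUnion.1 hc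
  obtain ⟨t, ht, hc⟩ := Finset.mem_biUnion.1 hc
  obtain ⟨k, -, rfl⟩ := Finset.mem_image.1 hc
  obtain ⟨⟨t, s⟩, hp, rfl⟩ := Finset.mem_image.1 ht
  obtain ⟨ht, hs⟩ := Finset.mem_product.1 hp
  cases k with
  | inl k => exact Finset.mem_biUnion.2 ⟨_, Finset.mem_univ _, Finset.mem_biUnion.2
      ⟨t, ht, Finset.mem_image_of_mem _ (Finset.mem_univ k)⟩⟩
  | inr x => exact Fintype.mem_piFinset.1 hs x

theorem mem_dissociateDB_adom {Δ : Fin m → Finset V} {i : Fin m}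
    (h : (q.atom i).ground ν ∈ D.facts) {x : V} (hx : x ∈ (q.atom i).vars) :
    ν x ∈ (q.dissociateDB Δ D).adom := by
  -- Added columns may be read at variables whose value under `ν` is not in the active domain;
  -- sending them to `ν x` makes the extended fact belong to the dissociated database.
  let ν' : V → C := fun z => if z ∈ (q.atom i).vars then ν z else ν x
  have hν' : (q.atom i).ground ν' = (q.atom i).ground ν :=
    Atom.ground_eq_ground_iff.2 fun z hz => if_pos hz
  have hmem : ((q.dissociate Δ).atom i).ground ν' ∈ (q.dissociateDB Δ D).facts := by
    refine ground_dissAtom_mem_facts.2 ⟨hν' ▸ h, fun z _ => ?_⟩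
    by_cases hz : z ∈ (q.atom i).vars
    · simpa only [ν', if_pos hz] using Atom.mem_adom_of_ground_mem h hz
    · simpa only [ν', if_neg hz] using Atom.mem_adom_of_ground_mem h hx
  have := Atom.mem_adom_of_ground_mem hmem (q.vars_subset_dissAtom_vars Δ i hx)
  simpa only [ν', if_pos hx] using this

/-- A plan has the same score on the database and on the dissociated database. -/
theorem score_dissociate {Δ : Fin m → Finset V} (hΔ : q.IsDissociation Δ) (D : PDB σ C)
    (h : P.Adapted (q.extendedVars Δ) H) (hw : q.WellFormed P) (hν : ∀ x ∈ H, ν x ∈ D.adom) :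
    (q.dissociate Δ).score (q.dissociateDB Δ D) P ν = q.score D P ν := by
  induction P generalizing H ν with
  | atom i =>
    have hi : q.extendedVars Δ i = H := h
    have hmem : ((q.dissociate Δ).atom i).ground ν ∈ (q.dissociateDB Δ D).facts ↔
        (q.atom i).ground ν ∈ D.facts := by
      -- At a leaf the added variables belong to `H`, hence were all given values in the active
      -- domain by the projections above.
      refine ground_dissAtom_mem_facts.trans (and_iff_left fun x hx => hν x (hi ▸ ?_))
      exact Finset.mem_sdiff.2 ⟨Finset.mem_union_right _ hx,
        (Finset.mem_sdiff.1 (Finset.mem_sdiff.1 (hΔ i hx)).1).2⟩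
    simp only [score]
    exact if_congr hmem rfl rfl
  | proj y P ih =>
    simp only [score]
    congr 1
    have hsub : (Fintype.piFinset fun _ : {x : V // x ∈ y} => (q.dissociateDB Δ D).adom) ⊆
        Fintype.piFinset fun _ => D.adom :=
      Fintype.piFinset_subset _ _ fun _ => q.dissociateDB_adom_subset Δ D
    -- Values in the active domain of `D` but not in that of `D^Δ` contribute the factor `1 - 0`: a
    -- nonzero score would place each of them in a fact matching a subgoal of `q`.
    rw [← Finset.prod_subset hsub fun μ _ hμ => ?_]
    · refine Finset.prod_congr rfl fun μ hμ => ?_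
      rw [ih h.2.2.2 hw.2.2.2 fun x hx => ?_]
      by_cases hxy : x ∈ y
      · rw [override_of_mem hxy]
        exact Fintype.mem_piFinset.1 (hsub hμ) _
      · rw [override_of_notMem hxy]
        exact hν x ((Finset.mem_union.1 hx).resolve_right hxy)
    · rw [sub_eq_self]
      by_contra hne
      refine hμ (Fintype.mem_piFinset.2 fun x => ?_)
      obtain ⟨i, ν', h1, h2, h3⟩ := exists_ground_mem_of_score_ne_zero hne (hw.2.1 x.2)
      rw [override_of_mem x.2] at h2
      exact h2 ▸ mem_dissociateDB_adom h3 h1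
  | join P ih =>
    exact Finset.prod_congr rfl fun j _ => ih j (h.2.1 j).2 (hw.2 j).2 hν

end CQ

end

end SafeDissociation

theorem mainTheorem3 {σ : SafeDissociation.Vocab} {V C : Type*} [Nonempty C] {m : ℕ} (hm : 1 ≤ m)
    (q : SafeDissociation.CQ σ V C m) (hq : q.SelfJoinFree) :
    ∃ e : q.QueryPlan ≃ q.SafeDiss,
      ∀ (P : SafeDissociation.Plan m V) (hP : q.IsPlan P) (Δ : Fin m → Finset V),
        (e (SafeDissociation.CQ.QueryPlan.mk P hP)).1 = Δ →
          Δ = q.dissociationOf P ∧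
          (∀ P' : SafeDissociation.Plan m V,
            ((q.dissociate Δ).IsPlan P' ∧ (q.dissociate Δ).SafePlan P') ↔ P'.Equiv P) ∧
          (∀ (D : SafeDissociation.PDB σ C) (a : V → C),
            (q.dissociate Δ).reliability (q.dissociateDB Δ D) a = q.score D P a ∧
            (q.dissociate Δ).score (q.dissociateDB Δ D) P a = q.score D P a) := by
  refine ⟨q.queryPlanEquiv hm, ?_⟩
  rintro P hP _ rfl
  rw [SafeDissociation.CQ.queryPlanEquiv_mk]
  -- `P` itself, read over `q^Δ`, is the safe plan; its exactness on `D^Δ` combined with the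
  -- equality of scores yields the reliability.
  have hsafe := hP.dissociate_iff.2 (.refl P)
  have hscore : ∀ D a, (q.dissociate (q.dissociationOf P)).score
      (q.dissociateDB (q.dissociationOf P) D) P a = q.score D P a := fun D a =>
    SafeDissociation.CQ.score_dissociate hP.isDissociation D hP.adapted hP.wellFormed (by simp)
  refine ⟨rfl, fun P' => hP.dissociate_iff, fun D a => ⟨?_, hscore D a⟩⟩
  exact ((SafeDissociation.CQ.dissociate_selfJoinFree q _).reliability_eq_score _ hsafe.1 hsafe.2
    a).trans (hscore D a)
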